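/- **Setting.** Let $\mu$ be a measure on $\mathbb R$, $k:\mathbb R\to\mathbb R$ measurable and $b:\mathbb R\to\mathbb R$ strictly convex and three times differentiable, such that $y\mapsto\exp\{y\eta-b(\eta)+k(y)\}$ is a probability density with respect to $\mu$ for every $\eta\in\mathbb R$, and such that for a constant $C_{\rm dev}\ge1$, $\sup_{|y|\le 1/2}b''(x+y)\le C_{\rm dev}\,b''(x)$ for all $x\in\mathbb R$. For each sample size $n$ let $\mathbf X=(x_{ij})\in\mathbb R^{n\times p}$ be non-random ($p=p_n$), with rows $x_i$ and columns $\mathbf x_j$, and $0\ne\theta_0\in\mathbb R^p$; under $\mathbb P_0^{(n)}$ the responses $Y_1,\dots,Y_n$ are independent and $Y_i$ has density $\exp\{y\,x_i^\top\theta_0-b(x_i^\top\theta_0)+k(y)\}$. Assume $p\ge n^C$ for a constant $C>0$. All asymptotic statements are for $n\to\infty$; all quantities may depend on $n$, except those called constants and $\mu,k,b$; and the non-asymptotic conditions below (with fixed constants) are required for all sufficiently large $n$. **Notation.** $S_\theta=\{j:\theta_j\ne0\}$, $S_0=S_{\theta_0}$, $s_0=|S_0|$. For $S\subseteq[p]$,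 $x_{i,S}=(x_{ij})_{j\in S}$ and $\mathbf X_S=(\mathbf x_j)_{j\in S}$; for $\theta_S\in\mathbb R^{|S|}$, $\widetilde\theta_S\in\mathbb R^p$ is its extension by zeros, $L_{n,\theta_S}=\sum_i\{Y_ix_{i,S}^\top\theta_S-b(x_{i,S}^\top\theta_S)+k(Y_i)\}$ and $\mathbf F_{n,\theta_S}=\sum_i b''(x_{i,S}^\top\theta_S)x_{i,S}x_{i,S}^\top$ (and $\mathbf F_{n,\theta}$ for $S=[p]$). $\widehat\theta_S^{\tt MLE}$ maximizes $L_{n,\theta_S}$ and $\theta_S^*$ maximizes $\mathbb E L_{n,\theta_S}$ over $\theta_S\in\mathbb R^{|S|}$. $\lambda_{\max},\lambda_{\min}$ are the largest and smallest singular values, $\rho_{\max,S},\rho_{\min,S}$ those of $\mathbf F_{n,\theta_S^*}$; $\|A\|_{\max}=\max_{i,j}|a_{ij}|$, $\|A\|_\infty=\max_i\sum_j|a_{ij}|$. Let $\zeta_{n,S}=\max_i\|\mathbf F_{n,\theta_S^*}^{-1/2}x_{i,S}\|_2$ and $\zeta_{n,\mathscr S}=\max_{S\in\mathscr S}\zeta_{n,S}$;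 $\sigma_{\max}^2=\max_i b''(x_i^\top\theta_0)$; $\nu_n=(1+\frac{2}{e\log2})(1+\frac{\sigma_{\max}^2}{\log2})$; $\mathbf W_0=\operatorname{diag}(b''(x_i^\top\theta_0))$; and $$\phi_2^2(s)=\inf\Big\{\frac{\theta^\top n^{-1}\mathbf X^\top\mathbf W_0\mathbf X\,\theta}{\|\theta\|_2^2}:0<|S_\theta|\le s\Big\}.$$ Fix any constants $K_{\rm dim}>1$ and $K_{\rm theta}>0$; put $\phi_2=\phi_2((K_{\rm dim}+1)s_0)$, $\mathscr S_{\Theta_n}=\{S:|S|\le K_{\rm dim}s_0,\ \|\mathbf F_{n,\theta_0}^{1/2}(\widetilde\theta_S-\theta_0)\|_2^2\le K_{\rm theta}s_0\log p\text{ for some }\theta_S\in\mathbb R^{|S|}\}$, $\widetilde{\mathscr S}_{\Theta_n}=\{S\cup S_0:S\in\mathscr S_{\Theta_n}\}$ and $\mathscr S_{\rm fp}=\{S\cup S_0:S\in\mathscr S_{\Theta_n},\ S\nsupseteq S_0\}$. **Prior.** $s_0\le s_{\max}\le\operatorname{rank}\mathbf X$; $w_n$ is a probability mass function on $\{0,\dots,s_{\max}\}$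 with $A_1p^{-A_3}w_n(s-1)\le w_n(s)\le A_2p^{-A_4}w_n(s-1)$ for $1\le s\le s_{\max}$, with constants $A_1,\dots,A_4>0$; $\lambda$ (which may depend on $n$) is the scale parameter of the conditional Gaussian prior $\mathcal N(\widehat\theta_S^{\tt MLE},\{\lambda\mathbf F_{n,\widehat\theta_S^{\tt MLE}}\}^{-1})$ and the constant $\alpha$ is the fractional power of the likelihood. **Assumptions.** (A1) There are non-random $D_n>\sqrt2$ and $\overline\theta_S$ with $\mathbf F_{n,\overline\theta_S}$ nonsingular ($|S|\le s_{\max}$) such that with $\mathbb P_0^{(n)}$-probability at least $1-p^{-1}$, for all $|S|\le s_{\max}$, the MLE exists, $D_n^{-1}\mathbf F_{n,\overline\theta_S}\preceq\mathbf F_{n,\widehat\theta_S^{\tt MLE}}\preceq D_n\mathbf F_{n,\overline\theta_S}$ and $\|\mathbf F_{n,\overline\theta_S}^{1/2}(\widehat\theta_S^{\tt MLE}-\overline\theta_S)\|_2^2\le D_n|S|\log p$. Moreover $\mathbf F_{n,\theta^*_{S_0}}$ is nonsingular and $\zeta_{n,S_0}^2s_0\log p=o(1)$. (A2) $\log(\sigma_{\max}^2\vee\|\mathbf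 X_{S_0}\|_\infty\vee\rho_{\min,S_0}^{-1}\vee\rho_{\max,S_0})=O(\log p)$; $s_0\log p=o(n)$; $p^{-A_5}\le\lambda\le A_6p^{-A_7}$ for constants $A_5,A_6>0$, $A_7\ge0$; $\alpha\in(0,1)$; $A_6p^{-A_7}<A_4$; $\log_pD_n=o(1)$. (A3) $\phi_2>0$ and $\|\mathbf X\|_{\max}^2s_0^2\log p/\phi_2^2=o(n)$. (A4) For constants $A_8,K_{\rm cubic}>0$: $\rho_{\max,S}\le p^{A_8}$ for $S\in\mathscr S_{\Theta_n}$, $\frac1n\sum_i|x_{i,S}^\top u|^3\le K_{\rm cubic}$ for all $S\in\mathscr S_{\Theta_n}\cup\widetilde{\mathscr S}_{\Theta_n}$ and all unit vectors $u\in\mathbb R^{|S|}$; and $\big[(s_0^3\log p)^{1/2}\zeta_{n,\mathscr S_{\Theta_n}}\big]\wedge\big[\frac{\sigma_{\max}^2}{\phi_2^3}(\frac{s_0^3\log p}{n})^{1/2}\big]=o(1)$. (A5) $A_4+A_7/2>16\alpha C_{\rm dev}+\log_p(s_0)+\delta_1$ for a constant $\delta_1>0$; and $\big[(s_0^3\log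 p)^{1/2}\zeta_{n,\widetilde{\mathscr S}_{\Theta_n}}\big]\wedge\big[\frac{\sigma_{\max}^2}{\phi_2^3}(\frac{s_0^3\log p}{n})^{1/2}\big]=o(1)$. (A6) $\|\mathbf X\|_{\max}^2\log p=o(n)$; $\max_j\|\mathbf x_j\|_2=O(n^{1/2})$; there is $\kappa_n>1$ with $\|\mathbf F_{n,\theta_S^*}^{-1}\|_\infty\le\kappa_nn^{-1}$ for all $S\in\mathscr S_{\rm fp}$; and $\big[\frac{(s_0^2\log p)^{1/2}\zeta_{n,\mathscr S_{\rm fp}}}{\phi_2\nu_n\kappa_n}\big]\wedge\big[\frac{\sigma_{\max}^2}{\phi_2^4\nu_n\kappa_n}(\frac{s_0^2\log p}{n})^{1/2}\big]=o(1)$. **Theorem.** Under (A1)–(A6) there is a constant $K>0$ such that, for all sufficiently large $n$, with $\mathbb P_0^{(n)}$-probability at least $1-3p^{-1}$, the MLE exists and is unique for every $S\in\mathscr S_{\rm fp}$ and $$\max_{S\in\mathscr S_{\rm fp}}\big\|\widehat\theta_S^{\tt MLE}-\theta_S^*\big\|_\infty\le K\,\nu_n\,\kappa_n\sqrt{\frac{\log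 p}{n}}.$$ -/

import Mathlib

open Filter Topology Asymptotics MeasureTheory Matrix

noncomputable section

namespace SparseGLM

/-! ## Matrix and vector notions -/

/-- The entrywise maximum norm of a matrix. -/
def maxNorm {m q : Type*} (A : Matrix m q ℝ) : ℝ := ⨆ i, ⨆ j, |A i j|

/-- The maximal absolute row sum of a matrix. -/
def rowSumNorm {m q : Type*} [Fintype q] (A : Matrix m q ℝ) : ℝ := ⨆ i, ∑ j, |A i j|

/-- The Euclidean norm of a vector given by its coordinates. -/
def l2norm {m : Type*} [Fintype m] (v : m → ℝ) : ℝ := √(∑ i, v i ^ 2)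

/-- The largest singular value of a square matrix: the maximum of the Euclidean norm of `A u`
over Euclidean unit vectors `u`. -/
def singularMax {m : Type*} [Fintype m] (A : Matrix m m ℝ) : ℝ :=
  sSup {r | ∃ u : m → ℝ, l2norm u = 1 ∧ r = l2norm (A *ᵥ u)}

/-- The smallest singular value of a square matrix: the minimum of the Euclidean norm of `A u`
over Euclidean unit vectors `u`. -/
def singularMin {m : Type*} [Fintype m] (A : Matrix m m ℝ) : ℝ :=
  sInf {r | ∃ u : m → ℝ, l2norm u = 1 ∧ r = l2norm (A *ᵥ u)}

/-- The quadratic form `v ↦ vᵀ A v`; for positive semidefinite `A` this is the squared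
Euclidean norm of `A^{1/2} v`. -/
def quad {m : Type*} [Fintype m] (A : Matrix m m ℝ) (v : m → ℝ) : ℝ := v ⬝ᵥ (A *ᵥ v)

/-- The set of nonzero coordinates of a vector. -/
def supp {p : ℕ} (θ : Fin p → ℝ) : Finset (Fin p) := Finset.univ.filter fun j => θ j ≠ 0

/-- The `p`-vector that agrees with `θ` on `S` and vanishes off `S`. -/
def extend {p : ℕ} {S : Finset (Fin p)} (θ : S → ℝ) : Fin p → ℝ :=
  fun j => if h : j ∈ S then θ ⟨j, h⟩ else 0

/-- The sparse singular value: the square root of the infimum of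
`θᵀ (n⁻¹ Xᵀ W X) θ / ‖θ‖₂²` over `θ` with at least one and at most `s` nonzero coordinates. -/
def phi2 {n p : ℕ} (X : Matrix (Fin n) (Fin p) ℝ) (W : Matrix (Fin n) (Fin n) ℝ) (s : ℝ) : ℝ :=
  √(sInf {r | ∃ θ : Fin p → ℝ, 0 < (supp θ).card ∧ ((supp θ).card : ℝ) ≤ s ∧
    r = quad ((n : ℝ)⁻¹ • (Xᵀ * W * X)) θ / l2norm θ ^ 2})

/-- `A` contains a measurable event of probability at least `q`. -/
def WithProbAtLeast {Ω : Type*} [MeasurableSpace Ω] (P : Measure Ω) (q : ℝ) (A : Set Ω) : Prop :=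
  ∃ E : Set Ω, MeasurableSet E ∧ E ⊆ A ∧ ENNReal.ofReal q ≤ P E

/-! ## Generalized linear models with canonical link -/

/-- A one-parameter exponential family with densities `y ↦ exp (y η - b η + k y)`, `η ∈ ℝ`,
with respect to a measure `base` on the line, whose cumulant function `b` is strictly convex,
three times differentiable, and satisfies `b'' (x + y) ≤ Cdev * b'' x` for `|y| ≤ 1/2`. -/
structure GLM where
  base : Measure ℝ
  k : ℝ → ℝ
  b : ℝ → ℝ
  Cdev : ℝ
  measurable_k : Measurable k
  /-- the densities integrate to one -/
  normalized : ∀ η : ℝ, ∫⁻ y, ENNReal.ofReal (Real.exp (y * η - b η + k y)) ∂base = 1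
  strictConvex_b : StrictConvexOn ℝ Set.univ b
  differentiable_b : Differentiable ℝ b
  differentiable_b' : Differentiable ℝ (deriv b)
  differentiable_b'' : Differentiable ℝ (deriv (deriv b))
  one_le_Cdev : 1 ≤ Cdev
  b''_le : ∀ x y : ℝ, |y| ≤ 1 / 2 → deriv (deriv b) (x + y) ≤ Cdev * deriv (deriv b) x

/-- The second derivative of the cumulant function. -/
def GLM.b'' (G : GLM) : ℝ → ℝ := deriv (deriv G.b)

/-- The law of a single response with natural parameter `η`. -/
def GLM.law (G : GLM) (η : ℝ) : Measure ℝ :=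
  G.base.withDensity fun y => ENNReal.ofReal (Real.exp (y * η - G.b η + G.k y))

section Model

variable (G : GLM) {n p : ℕ} (X : Matrix (Fin n) (Fin p) ℝ)

/-- The joint law of the independent responses `Y₁, …, Yₙ` under the coefficient vector `θ`. -/
def jointLaw (θ : Fin p → ℝ) : Measure (Fin n → ℝ) := Measure.pi fun i => G.law (X i ⬝ᵥ θ)

/-- The submatrix of the columns with index in `S`. -/
def colSub (S : Finset (Fin p)) : Matrix (Fin n) S ℝ := X.submatrix id Subtype.val

/-- The linear predictor of observation `i` in model `S`. -/
def linPred (S : Finset (Fin p)) (θ : S → ℝ) (i : Fin n) : ℝ := colSub X S i ⬝ᵥ θ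

/-- The log-likelihood of model `S`. -/
def logLik (S : Finset (Fin p)) (θ : S → ℝ) (y : Fin n → ℝ) : ℝ :=
  ∑ i, (y i * linPred X S θ i - G.b (linPred X S θ i) + G.k (y i))

/-- `θ` is a maximum likelihood estimate in model `S` for the data `y`. -/
def IsMLE (S : Finset (Fin p)) (y : Fin n → ℝ) (θ : S → ℝ) : Prop :=
  ∀ θ' : S → ℝ, logLik G X S θ' y ≤ logLik G X S θ y

/-- `θ` maximizes the expected log-likelihood of model `S`, the responses having coefficient
vector `θ₀`. The comparison is made through the expectation of the difference of two
log-likelihoods, so that integrability of `k (Yᵢ)` plays no role. -/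
def IsBest (θ₀ : Fin p → ℝ) (S : Finset (Fin p)) (θ : S → ℝ) : Prop :=
  ∀ θ' : S → ℝ, ∫ y, (logLik G X S θ' y - logLik G X S θ y) ∂(jointLaw G X θ₀) ≤ 0

/-- The maximizer of the expected log-likelihood of model `S`. -/
def best (θ₀ : Fin p → ℝ) (S : Finset (Fin p)) : S → ℝ := Classical.epsilon (IsBest G X θ₀ S)

/-- The diagonal matrix of the variances `b'' (xᵢᵀ θ)`. -/
def weight (θ : Fin p → ℝ) : Matrix (Fin n) (Fin n) ℝ :=
  Matrix.diagonal fun i => G.b'' (X i ⬝ᵥ θ)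

/-- The Fisher information matrix of the full model. -/
def fisherFull (θ : Fin p → ℝ) : Matrix (Fin p) (Fin p) ℝ := Xᵀ * weight G X θ * X

/-- The Fisher information matrix of model `S`. -/
def fisher (S : Finset (Fin p)) (θ : S → ℝ) : Matrix S S ℝ :=
  (colSub X S)ᵀ * Matrix.diagonal (fun i => G.b'' (linPred X S θ i)) * colSub X S

/-- The Fisher information matrix of model `S` at the maximizer of the expected
log-likelihood. -/
def fisherBest (θ₀ : Fin p → ℝ) (S : Finset (Fin p)) : Matrix S S ℝ :=
  fisher G X S (best G X θ₀ S)

/-- The design regularity `max_i ‖F^{-1/2} x_{i,S}‖₂`, with `F` the Fisher information of model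
`S` at the maximizer of the expected log-likelihood. -/
def designReg (θ₀ : Fin p → ℝ) (S : Finset (Fin p)) : ℝ :=
  ⨆ i, √(quad (fisherBest G X θ₀ S)⁻¹ (colSub X S i))

/-- The maximum of the design regularity over a family of models. -/
def designRegMax (θ₀ : Fin p → ℝ) (𝒮 : Set (Finset (Fin p))) : ℝ :=
  ⨆ S : 𝒮, designReg G X θ₀ S

/-- The maximal variance `max_i b'' (xᵢᵀ θ₀)`. -/
def sigmaMaxSq (θ₀ : Fin p → ℝ) : ℝ := ⨆ i, G.b'' (X i ⬝ᵥ θ₀)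

/-- The constant `(1 + 2 / (e log 2)) (1 + σ_max² / log 2)`. -/
def nu (θ₀ : Fin p → ℝ) : ℝ :=
  (1 + 2 / (Real.exp 1 * Real.log 2)) * (1 + sigmaMaxSq G X θ₀ / Real.log 2)

/-- The models of size at most `Kdim s₀` containing the support of some `θ` with
`‖F_{θ₀}^{1/2} (θ - θ₀)‖₂² ≤ Ktheta s₀ log p`. -/
def modelsNear (θ₀ : Fin p → ℝ) (Kdim Ktheta : ℝ) : Set (Finset (Fin p)) :=
  {S | (S.card : ℝ) ≤ Kdim * (supp θ₀).card ∧
    ∃ θ : S → ℝ, quad (fisherFull G X θ₀) (extend θ - θ₀) ≤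
      Ktheta * (supp θ₀).card * Real.log p}

/-- The models `S ∪ S₀` with `S` in `modelsNear`. -/
def modelsUnion (θ₀ : Fin p → ℝ) (Kdim Ktheta : ℝ) : Set (Finset (Fin p)) :=
  {T | ∃ S ∈ modelsNear G X θ₀ Kdim Ktheta, T = S ∪ supp θ₀}

/-- The models `S ∪ S₀` with `S` in `modelsNear` missing some index of `S₀`. -/
def modelsFP (θ₀ : Fin p → ℝ) (Kdim Ktheta : ℝ) : Set (Finset (Fin p)) :=
  {T | ∃ S ∈ modelsNear G X θ₀ Kdim Ktheta, ¬ supp θ₀ ⊆ S ∧ T = S ∪ supp θ₀}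

end Model

/-! ## Sequences of problems and the assumptions -/

/-- The data of a sequence of sparse regression problems indexed by the sample size `n`:
the number `p n` of covariates, the design matrix, the true coefficient vector, and the
ingredients of the prior, namely the maximal model size `smax n`, the mass function `w n` of the
model size, and the scale `lam n` of the conditional Gaussian density. -/
structure Regime where
  p : ℕ → ℕ
  X : ∀ n, Matrix (Fin n) (Fin (p n)) ℝ
  θ₀ : ∀ n, Fin (p n) → ℝ
  smax : ℕ → ℕ
  w : ℕ → ℕ → ℝ
  lam : ℕ → ℝ

variable (G : GLM) (R : Regime)

/-- `log p`. -/
def Regime.logp (n : ℕ) : ℝ := Real.log (R.p n)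

/-- The true model. -/
def Regime.S₀ (n : ℕ) : Finset (Fin (R.p n)) := supp (R.θ₀ n)

/-- The size of the true model. -/
def Regime.s₀ (n : ℕ) : ℝ := (R.S₀ n).card

/-- `φ₂ ((Kdim + 1) s₀; W₀)`. -/
def Regime.phi (Kdim : ℝ) (n : ℕ) : ℝ :=
  phi2 (R.X n) (weight G (R.X n) (R.θ₀ n)) ((Kdim + 1) * R.s₀ n)

/-- The law of the responses under the true coefficient vector. -/
def Regime.law (n : ℕ) : Measure (Fin n → ℝ) := jointLaw G (R.X n) (R.θ₀ n)

/-- Standing assumptions: `θ₀ ≠ 0`, `p ≥ n ^ C` for a constant `C > 0`, and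
`s₀ ≤ s_max ≤ rank X`. -/
def Standing : Prop :=
  (∃ C : ℝ, 0 < C ∧ ∀ᶠ n : ℕ in atTop, (n : ℝ) ^ C ≤ R.p n) ∧
  ∀ᶠ n in atTop, R.θ₀ n ≠ 0 ∧ (R.S₀ n).card ≤ R.smax n ∧ R.smax n ≤ (R.X n).rank

/-- The prior on the model size: a mass function on `{0, …, s_max}` with
`A₁ p^{-A₃} w(s-1) ≤ w(s) ≤ A₂ p^{-A₄} w(s-1)` for `1 ≤ s ≤ s_max`. -/
def PriorSize (A₁ A₂ A₃ A₄ : ℝ) : Prop :=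
  0 < A₁ ∧ 0 < A₂ ∧ 0 < A₃ ∧ 0 < A₄ ∧
  ∀ᶠ n in atTop,
    (∀ s, 0 ≤ R.w n s) ∧ ∑ s ∈ Finset.range (R.smax n + 1), R.w n s = 1 ∧
    (∀ s, R.smax n < s → R.w n s = 0) ∧
    ∀ s ∈ Finset.Icc 1 (R.smax n),
      A₁ * (R.p n : ℝ) ^ (-A₃) * R.w n (s - 1) ≤ R.w n s ∧
      R.w n s ≤ A₂ * (R.p n : ℝ) ^ (-A₄) * R.w n (s - 1)

/-- The maximum likelihood estimates of all models of size at most `s_max` are close to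
non-random vectors with nonsingular Fisher information, and the true model is regular. -/
def CondA1 (D : ℕ → ℝ) : Prop :=
  (∀ᶠ n in atTop, √2 < D n ∧
    ∃ θbar : ∀ S : Finset (Fin (R.p n)), S → ℝ,
      (∀ S : Finset (Fin (R.p n)), S.card ≤ R.smax n →
        IsUnit (fisher G (R.X n) S (θbar S)).det) ∧
      WithProbAtLeast (R.law G n) (1 - (R.p n : ℝ)⁻¹)
        {y | ∀ S : Finset (Fin (R.p n)), S.card ≤ R.smax n →
          ∃ θhat : S → ℝ, IsMLE G (R.X n) S y θhat ∧
            (fisher G (R.X n) S θhat - (D n)⁻¹ • fisher G (R.X n) S (θbar S)).PosSemidef ∧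
            (D n • fisher G (R.X n) S (θbar S) - fisher G (R.X n) S θhat).PosSemidef ∧
            quad (fisher G (R.X n) S (θbar S)) (θhat - θbar S) ≤ D n * S.card * R.logp n}) ∧
  (∀ᶠ n in atTop, IsUnit (fisherBest G (R.X n) (R.θ₀ n) (R.S₀ n)).det) ∧
  Tendsto (fun n => designReg G (R.X n) (R.θ₀ n) (R.S₀ n) ^ 2 * R.s₀ n * R.logp n) atTop (𝓝 0)

/-- Growth conditions on the true model, the prior scale `lam` and the fractional power. -/
def CondA2 (D : ℕ → ℝ) (α A₄ A₅ A₆ A₇ : ℝ) : Prop :=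
  (fun n => Real.log (max (max (sigmaMaxSq G (R.X n) (R.θ₀ n))
      (rowSumNorm (colSub (R.X n) (R.S₀ n))))
      (max (singularMin (fisherBest G (R.X n) (R.θ₀ n) (R.S₀ n)))⁻¹
        (singularMax (fisherBest G (R.X n) (R.θ₀ n) (R.S₀ n))))))
    =O[atTop] (fun n => R.logp n) ∧
  (fun n => R.s₀ n * R.logp n) =o[atTop] (fun n : ℕ => (n : ℝ)) ∧
  0 < A₅ ∧ 0 < A₆ ∧ 0 ≤ A₇ ∧
  (∀ᶠ n in atTop, (R.p n : ℝ) ^ (-A₅) ≤ R.lam n ∧ R.lam n ≤ A₆ * (R.p n : ℝ) ^ (-A₇)) ∧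
  0 < α ∧ α < 1 ∧
  (∀ᶠ n in atTop, A₆ * (R.p n : ℝ) ^ (-A₇) < A₄) ∧
  Tendsto (fun n => Real.logb (R.p n) (D n)) atTop (𝓝 0)

/-- `‖X‖_max² s₀² log p / φ₂² = o(n)`, the number `φ₂` being positive. -/
def CondA3 (Kdim : ℝ) : Prop :=
  (∀ᶠ n in atTop, 0 < R.phi G Kdim n) ∧
  (fun n => maxNorm (R.X n) ^ 2 * R.s₀ n ^ 2 * R.logp n / R.phi G Kdim n ^ 2)
    =o[atTop] (fun n : ℕ => (n : ℝ))

/-- Polynomially bounded eigenvalues, bounded empirical third moments, and a small error of the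
quadratic approximation. -/
def CondA4 (Kdim Ktheta A₈ Kcubic : ℝ) : Prop :=
  0 < A₈ ∧ 0 < Kcubic ∧
  (∀ᶠ n in atTop,
    (∀ S ∈ modelsNear G (R.X n) (R.θ₀ n) Kdim Ktheta,
      singularMax (fisherBest G (R.X n) (R.θ₀ n) S) ≤ (R.p n : ℝ) ^ A₈) ∧
    ∀ S ∈ modelsNear G (R.X n) (R.θ₀ n) Kdim Ktheta ∪ modelsUnion G (R.X n) (R.θ₀ n) Kdim Ktheta,
      ∀ u : S → ℝ, l2norm u = 1 → (1 / n : ℝ) * ∑ i, |linPred (R.X n) S u i| ^ 3 ≤ Kcubic) ∧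
  Tendsto (fun n : ℕ => min
      (√(R.s₀ n ^ 3 * R.logp n) *
        designRegMax G (R.X n) (R.θ₀ n) (modelsNear G (R.X n) (R.θ₀ n) Kdim Ktheta))
      (sigmaMaxSq G (R.X n) (R.θ₀ n) / R.phi G Kdim n ^ 3 * √(R.s₀ n ^ 3 * R.logp n / n)))
    atTop (𝓝 0)

/-- A strong enough prior penalty, and the error bound of the quadratic approximation for the
enlarged models. -/
def CondA5 (Kdim Ktheta α A₄ A₇ : ℝ) : Prop :=
  (∃ δ₁ : ℝ, 0 < δ₁ ∧ ∀ᶠ n in atTop,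
    α * (16 * G.Cdev) + Real.logb (R.p n) (R.s₀ n) + δ₁ < A₄ + A₇ / 2) ∧
  Tendsto (fun n : ℕ => min
      (√(R.s₀ n ^ 3 * R.logp n) *
        designRegMax G (R.X n) (R.θ₀ n) (modelsUnion G (R.X n) (R.θ₀ n) Kdim Ktheta))
      (sigmaMaxSq G (R.X n) (R.θ₀ n) / R.phi G Kdim n ^ 3 * √(R.s₀ n ^ 3 * R.logp n / n)))
    atTop (𝓝 0)

/-- Conditions on the columns of the design and on the maximal absolute row sums of the inverse
Fisher information matrices. -/
def CondA6 (Kdim Ktheta : ℝ) (κ : ℕ → ℝ) : Prop :=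
  (fun n => maxNorm (R.X n) ^ 2 * R.logp n) =o[atTop] (fun n : ℕ => (n : ℝ)) ∧
  (fun n => ⨆ j, l2norm (fun i => R.X n i j)) =O[atTop] (fun n : ℕ => √(n : ℝ)) ∧
  (∀ᶠ n : ℕ in atTop, 1 < κ n ∧ ∀ S ∈ modelsFP G (R.X n) (R.θ₀ n) Kdim Ktheta,
    rowSumNorm (fisherBest G (R.X n) (R.θ₀ n) S)⁻¹ ≤ κ n * (n : ℝ)⁻¹) ∧
  Tendsto (fun n : ℕ => min
      (√(R.s₀ n ^ 2 * R.logp n) *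
          designRegMax G (R.X n) (R.θ₀ n) (modelsFP G (R.X n) (R.θ₀ n) Kdim Ktheta) /
        (R.phi G Kdim n * nu G (R.X n) (R.θ₀ n) * κ n))
      (sigmaMaxSq G (R.X n) (R.θ₀ n) /
          (R.phi G Kdim n ^ 4 * nu G (R.X n) (R.θ₀ n) * κ n) *
        √(R.s₀ n ^ 2 * R.logp n / n)))
    atTop (𝓝 0)

end SparseGLM

end

open SparseGLM

/-!
For every model `S` in question, `S ⊇ S₀` and `|S|` is at most a constant times `s₀`. Then the
expected log-likelihood ratio is a sum of Bregman divergences of `b` with base point the truth, so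
the best approximation `θ*` is the restriction of `θ₀` (`best_eq_restrict`), and the Fisher
information `F` at `θ*` is bounded below by `n φ₂²` (`phi2_sq_mul_le_quad`).

*Probability.* The moment generating function of a centred response is `exp` of the increment of
`b` minus its linear part, hence at most `exp (C b'' t² / 2)` for `|t| ≤ 1/2`. The resulting Chernoff
bound (`measureReal_le_sum_centred_le`) is used twice. Applied to the columns of the design, it bounds
the score in the maximum norm by a multiple of `(1 + σ_max²) √(n log p)`, off an event of probability
`2/p` (`exists_event_abs_score_le`). Applied to a finite norming set of directions in each model,
it bounds the norm of `F^{-1/2}` times the score by a multiple of `√(|S| log p)` for all models at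
once, off an event of probability `1/p` (`exists_event_forall_score_le`). A union bound over
`p ^ O(|S|)` directions costs only a constant, so a crude cubic grid serves as a norming set.
The condition `‖X‖_max² s₀² log p / φ₂² = o(n)` keeps the exponents in the range `|t| ≤ 1/2`.

*Localization.* By concavity of the log-likelihood, the second bound forces the unique maximizer
into the ellipsoid `‖F^{1/2} (θ - θ*)‖ ≲ √(s₀ log p)` (`existsUnique_mle_of_score_le`).

*Linearization.* The likelihood equations read `F (θ - θ*) = score - R`. The assumption on `b''` does
not bound the third derivative of `b` by a multiple of `b''`, only by one of `(1 + √b'') b''`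
(`GLM.abs_deriv_b_sub_sub_le`). This suffices, because `R` is bounded entrywise by a multiple of
`‖X‖_max (1 + σ_max) s₀ log p`, where `‖X‖_max s₀ √(log p) ≤ φ₂ √n` and
`φ₂ ≤ σ_max max_j ‖x_j‖ / √n` (`phi2_le`), so that `R` is no larger than the bound for the score.
Multiplying by `F⁻¹`, whose absolute row sums are at most `κ / n`, gives the claim
(`IsMLE.abs_sub_le`, `score_add_remainder_le`).
-/

noncomputable section

namespace SparseGLM

open ProbabilityTheory

/-! ### Moments and Taylor bounds for the exponential family -/

namespace GLM

variable (G : GLM)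

lemma measurable_density (η : ℝ) :
    Measurable fun y => ENNReal.ofReal (Real.exp (y * η - G.b η + G.k y)) := by
  have := G.measurable_k
  fun_prop

lemma hasDerivAt_b (x : ℝ) : HasDerivAt G.b (deriv G.b x) x := (G.differentiable_b x).hasDerivAt

lemma hasDerivAt_deriv_b (x : ℝ) : HasDerivAt (deriv G.b) (G.b'' x) x :=
  (G.differentiable_b' x).hasDerivAt

lemma continuous_b : Continuous G.b := G.differentiable_b.continuous

instance isProbabilityMeasure_law (η : ℝ) : IsProbabilityMeasure (G.law η) := by
  refine ⟨?_⟩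
  rw [law, withDensity_apply _ MeasurableSet.univ, Measure.restrict_univ, G.normalized]

/-- The Laplace transform of the law with parameter `η`, read off from the normalization of the
law with parameter `η + t`. -/
lemma lintegral_exp_law (η t : ℝ) :
    ∫⁻ y, ENNReal.ofReal (Real.exp (t * y)) ∂(G.law η) =
      ENNReal.ofReal (Real.exp (G.b (η + t) - G.b η)) := by
  rw [law, lintegral_withDensity_eq_lintegral_mul _ (G.measurable_density η) (by fun_prop)]
  have h : ∀ y, ENNReal.ofReal (Real.exp (y * η - G.b η + G.k y)) *
      ENNReal.ofReal (Real.exp (t * y)) = ENNReal.ofReal (Real.exp (G.b (η + t) - G.b η)) *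
        ENNReal.ofReal (Real.exp (y * (η + t) - G.b (η + t) + G.k y)) := by
    intro y
    rw [← ENNReal.ofReal_mul (Real.exp_nonneg _), ← ENNReal.ofReal_mul (Real.exp_nonneg _),
      ← Real.exp_add, ← Real.exp_add]
    ring_nf
  simp only [Pi.mul_apply, h]
  rw [lintegral_const_mul _ (G.measurable_density _), G.normalized, mul_one]

lemma integrable_exp_law (η t : ℝ) : Integrable (fun y => Real.exp (t * y)) (G.law η) := by
  refine ⟨by fun_prop, ?_⟩
  rw [hasFiniteIntegral_iff_ofReal (ae_of_all _ fun y => Real.exp_nonneg _), lintegral_exp_law]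
  exact ENNReal.ofReal_lt_top

/-- A response centred at the derivative of the cumulant function. -/
def centred (η : ℝ) : ℝ → ℝ := fun y => y - deriv G.b η

/-- The cumulant function of the centred response with parameter `η`. -/
def cumulant (η t : ℝ) : ℝ := G.b (η + t) - G.b η - deriv G.b η * t

lemma integrable_exp_centred (η t : ℝ) :
    Integrable (fun y => Real.exp (t * G.centred η y)) (G.law η) := by
  have := (G.integrable_exp_law η t).mul_const (Real.exp (-(t * deriv G.b η)))
  refine this.congr (ae_of_all _ fun y => ?_)
  simp only [centred]
  rw [← Real.exp_add]
  ring_nf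

lemma mgf_centred (η t : ℝ) :
    mgf (G.centred η) (G.law η) t = Real.exp (G.cumulant η t) := by
  have h1 : ∫ y, Real.exp (t * y) ∂(G.law η) = Real.exp (G.b (η + t) - G.b η) := by
    rw [integral_eq_lintegral_of_nonneg_ae (ae_of_all _ fun y => Real.exp_nonneg _) (by fun_prop),
      lintegral_exp_law, ENNReal.toReal_ofReal (Real.exp_nonneg _)]
  have h2 : ∀ y, Real.exp (t * G.centred η y) =
      Real.exp (t * y) * Real.exp (-(t * deriv G.b η)) := by
    intro y
    rw [← Real.exp_add, centred]
    ring_nf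
  rw [mgf]
  simp only [h2]
  rw [integral_mul_const, h1, ← Real.exp_add, cumulant]
  ring_nf

lemma mem_interior_integrableExpSet (η t : ℝ) :
    t ∈ interior (integrableExpSet (G.centred η) (G.law η)) := by
  have : integrableExpSet (G.centred η) (G.law η) = Set.univ :=
    Set.eq_univ_of_forall fun t => G.integrable_exp_centred η t
  simp [this]

lemma integrable_pow_mul_exp_centred (η t : ℝ) (k : ℕ) :
    Integrable (fun y => G.centred η y ^ k * Real.exp (t * G.centred η y)) (G.law η) :=
  integrable_pow_mul_exp_of_mem_interior_integrableExpSet (G.mem_interior_integrableExpSet η t) k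

lemma hasDerivAt_cumulant (η t : ℝ) :
    HasDerivAt (G.cumulant η) (deriv G.b (η + t) - deriv G.b η) t := by
  have h1 : HasDerivAt (fun t => G.b (η + t)) (deriv G.b (η + t)) t := by
    simpa using (G.hasDerivAt_b (η + t)).comp_const_add η t
  have h2 := (h1.sub_const (G.b η)).sub ((hasDerivAt_id t).const_mul (deriv G.b η))
  exact h2.congr_deriv (by simp)

lemma hasDerivAt_deriv_b_add (η t : ℝ) :
    HasDerivAt (fun t => deriv G.b (η + t) - deriv G.b η) (G.b'' (η + t)) t := by
  simpa using ((G.hasDerivAt_deriv_b (η + t)).comp_const_add η t).sub_const (deriv G.b η)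

lemma integral_centred_mul_exp (η t : ℝ) :
    ∫ y, G.centred η y * Real.exp (t * G.centred η y) ∂(G.law η) =
      (deriv G.b (η + t) - deriv G.b η) * Real.exp (G.cumulant η t) := by
  have h1 := hasDerivAt_mgf (G.mem_interior_integrableExpSet η t)
  have h2 : mgf (G.centred η) (G.law η) = fun t => Real.exp (G.cumulant η t) :=
    funext fun t => G.mgf_centred η t
  rw [h2] at h1
  rw [h1.unique (G.hasDerivAt_cumulant η t).exp, mul_comm]

lemma integral_centred_sq_mul_exp (η t : ℝ) :
    ∫ y, G.centred η y ^ 2 * Real.exp (t * G.centred η y) ∂(G.law η) =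
      (G.b'' (η + t) + (deriv G.b (η + t) - deriv G.b η) ^ 2) * Real.exp (G.cumulant η t) := by
  have h1 := hasDerivAt_integral_pow_mul_exp_real (G.mem_interior_integrableExpSet η t) 1
  simp only [pow_one, G.integral_centred_mul_exp η] at h1
  rw [h1.unique ((G.hasDerivAt_deriv_b_add η t).mul (G.hasDerivAt_cumulant η t).exp)]
  ring

lemma cumulant_zero (η : ℝ) : G.cumulant η 0 = 0 := by simp [cumulant]

lemma integral_centred (η : ℝ) : ∫ y, G.centred η y ∂(G.law η) = 0 := by
  simpa using G.integral_centred_mul_exp η 0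

lemma integral_centred_sq (η : ℝ) : ∫ y, G.centred η y ^ 2 ∂(G.law η) = G.b'' η := by
  simpa [cumulant_zero] using G.integral_centred_sq_mul_exp η 0

lemma integrable_centred (η : ℝ) : Integrable (G.centred η) (G.law η) := by
  simpa using G.integrable_pow_mul_exp_centred η 0 1

lemma integrable_id_law (η : ℝ) : Integrable (fun y : ℝ => y) (G.law η) := by
  exact ((G.integrable_centred η).add (integrable_const (deriv G.b η))).congr
    (ae_of_all _ fun y => by simp [centred])

lemma integral_id_law (η : ℝ) : ∫ y, y ∂(G.law η) = deriv G.b η := by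
  have h := G.integral_centred η
  simp only [centred] at h
  rw [integral_sub (G.integrable_id_law η) (integrable_const _)] at h
  simp at h
  linarith

lemma b''_nonneg (η : ℝ) : 0 ≤ G.b'' η := by
  rw [← G.integral_centred_sq η]
  exact integral_nonneg fun y => sq_nonneg _

lemma Cdev_pos : 0 < G.Cdev := lt_of_lt_of_le one_pos G.one_le_Cdev

lemma b''_add_le (η : ℝ) {t : ℝ} (ht : |t| ≤ 1 / 2) : G.b'' (η + t) ≤ G.Cdev * G.b'' η :=
  G.b''_le η t ht

lemma b''_le_mul_add (η : ℝ) {t : ℝ} (ht : |t| ≤ 1 / 2) : G.b'' η ≤ G.Cdev * G.b'' (η + t) := by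
  simpa using G.b''_add_le (η + t) (t := -t) (by simpa using ht)

/-- The mean value theorem for the derivative of the cumulant function. -/
lemma exists_deriv_b_sub_eq (η t : ℝ) :
    ∃ c, |c| ≤ |t| ∧ deriv G.b (η + t) - deriv G.b η = G.b'' (η + c) * t := by
  rcases lt_trichotomy t 0 with h | rfl | h
  · obtain ⟨c, hc, e⟩ := exists_hasDerivAt_eq_slope (fun t => deriv G.b (η + t) - deriv G.b η)
      (fun t => G.b'' (η + t)) h
      (fun x _ => (G.hasDerivAt_deriv_b_add η x).continuousAt.continuousWithinAt)
      (fun x _ => G.hasDerivAt_deriv_b_add η x)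
    refine ⟨c, ?_, ?_⟩
    · rw [abs_of_neg hc.2, abs_of_neg h]; linarith [hc.1]
    · rw [e]; simp; rw [div_neg, neg_mul, div_mul_cancel₀ _ h.ne]; ring
  · exact ⟨0, by simp⟩
  · obtain ⟨c, hc, e⟩ := exists_hasDerivAt_eq_slope (fun t => deriv G.b (η + t) - deriv G.b η)
      (fun t => G.b'' (η + t)) h
      (fun x _ => (G.hasDerivAt_deriv_b_add η x).continuousAt.continuousWithinAt)
      (fun x _ => G.hasDerivAt_deriv_b_add η x)
    refine ⟨c, ?_, ?_⟩
    · rw [abs_of_pos hc.1, abs_of_pos h]; linarith [hc.2]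
    · rw [e]; simp; field_simp

lemma abs_deriv_b_sub_le (η : ℝ) {t : ℝ} (ht : |t| ≤ 1 / 2) :
    |deriv G.b (η + t) - deriv G.b η| ≤ G.Cdev * G.b'' η * |t| := by
  obtain ⟨c, hc, e⟩ := G.exists_deriv_b_sub_eq η t
  rw [e, abs_mul, abs_of_nonneg (G.b''_nonneg _)]
  exact mul_le_mul_of_nonneg_right (G.b''_add_le η (hc.trans ht)) (abs_nonneg _)

lemma nonneg_of_mul_deriv_nonneg {f f' : ℝ → ℝ} {a : ℝ} (hf : ∀ t, HasDerivAt f (f' t) t)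
    (h0 : f 0 = 0) (h : ∀ t, |t| ≤ a → 0 ≤ t * f' t) {t : ℝ} (ht : |t| ≤ a) : 0 ≤ f t := by
  rcases lt_trichotomy t 0 with h1 | rfl | h1
  · obtain ⟨c, hc, e⟩ := exists_hasDerivAt_eq_slope f f' h1
      (fun x _ => (hf x).continuousAt.continuousWithinAt) (fun x _ => hf x)
    have h2 := h c (by rw [abs_of_neg hc.2]; rw [abs_of_neg h1] at ht; linarith [hc.1])
    have h3 : f' c ≤ 0 := by
      by_contra h4
      nlinarith [hc.2]
    rw [h0, eq_div_iff (by linarith)] at e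
    nlinarith
  · exact h0.ge
  · obtain ⟨c, hc, e⟩ := exists_hasDerivAt_eq_slope f f' h1
      (fun x _ => (hf x).continuousAt.continuousWithinAt) (fun x _ => hf x)
    have h2 := h c (by rw [abs_of_pos hc.1]; rw [abs_of_pos h1] at ht; linarith [hc.2])
    have h3 : 0 ≤ f' c := by
      by_contra h4
      nlinarith [hc.1]
    rw [h0, eq_div_iff (by linarith)] at e
    nlinarith

lemma cumulant_le (η : ℝ) {t : ℝ} (ht : |t| ≤ 1 / 2) :
    G.cumulant η t ≤ G.Cdev * G.b'' η / 2 * t ^ 2 := by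
  have h := nonneg_of_mul_deriv_nonneg (a := 1 / 2)
    (f := fun t => G.Cdev * G.b'' η / 2 * t ^ 2 - G.cumulant η t)
    (f' := fun t => G.Cdev * G.b'' η * t - (deriv G.b (η + t) - deriv G.b η))
    (fun t => by
      have h := (((hasDerivAt_id t).pow 2).const_mul (G.Cdev * G.b'' η / 2)).sub
        (G.hasDerivAt_cumulant η t)
      exact h.congr_deriv (by simp; ring)) (by simp [cumulant_zero])
    (fun t ht => by
      obtain ⟨c, hc, e⟩ := G.exists_deriv_b_sub_eq η t
      rw [e]
      have := G.b''_add_le η (hc.trans ht)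
      nlinarith [sq_nonneg t]) ht
  simpa using h

lemma le_cumulant (η : ℝ) {t : ℝ} (ht : |t| ≤ 1 / 2) :
    G.b'' η / (2 * G.Cdev) * t ^ 2 ≤ G.cumulant η t := by
  have hC := G.Cdev_pos
  have h := nonneg_of_mul_deriv_nonneg (a := 1 / 2)
    (f := fun t => G.cumulant η t - G.b'' η / (2 * G.Cdev) * t ^ 2)
    (f' := fun t => (deriv G.b (η + t) - deriv G.b η) - G.b'' η / G.Cdev * t)
    (fun t => by
      have h := (G.hasDerivAt_cumulant η t).sub
        (((hasDerivAt_id t).pow 2).const_mul (G.b'' η / (2 * G.Cdev)))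
      exact h.congr_deriv (by simp; field_simp)) (by simp [cumulant_zero])
    (fun t ht => by
      obtain ⟨c, hc, e⟩ := G.exists_deriv_b_sub_eq η t
      rw [e]
      have := G.b''_le_mul_add η (hc.trans ht)
      have h2 : G.b'' η / G.Cdev ≤ G.b'' (η + c) := by
        rw [div_le_iff₀ hC]; linarith
      nlinarith [sq_nonneg t]) ht
  simpa using h

end GLM

lemma abs_exp_sub_one_sub_self_le (x : ℝ) :
    |Real.exp x - 1 - x| ≤ x ^ 2 * Real.exp |x| := by
  have h := Complex.norm_exp_sub_sum_le_norm_mul_exp (x : ℂ) 2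
  have e : Complex.exp x - ∑ m ∈ Finset.range 2, (x : ℂ) ^ m / (m.factorial : ℂ) =
      ((Real.exp x - 1 - x : ℝ) : ℂ) := by
    simp [Finset.sum_range_succ]
    ring
  rw [e] at h
  simpa only [Complex.norm_real, Real.norm_eq_abs, sq_abs] using h

lemma abs_mul_exp_sub_le {y τ : ℝ} (hτ : 0 < τ) (hy : |y| ≤ τ) (z : ℝ) :
    |z * (Real.exp (y * z) - 1 - y * z)| ≤
      y ^ 2 / τ * (z ^ 2 * Real.exp (2 * τ * z) + z ^ 2 * Real.exp (-(2 * τ) * z)) := by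
  have h1 := abs_exp_sub_one_sub_self_le (y * z)
  have h2 : |z| ≤ Real.exp (τ * |z|) / τ := by
    rw [le_div_iff₀ hτ]
    have := Real.add_one_le_exp (τ * |z|)
    linarith
  have h3 : Real.exp |y * z| ≤ Real.exp (τ * |z|) := by
    rw [abs_mul]
    gcongr
  have h4 : Real.exp (τ * |z|) * Real.exp (τ * |z|) ≤
      Real.exp (2 * τ * z) + Real.exp (-(2 * τ) * z) := by
    rw [← Real.exp_add]
    rcases abs_cases z with ⟨e, -⟩ | ⟨e, -⟩ <;> rw [e]
    · have := Real.exp_pos (-(2 * τ) * z)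
      have e : τ * z + τ * z = 2 * τ * z := by ring
      rw [e]; linarith
    · have := Real.exp_pos (2 * τ * z)
      have e : τ * -z + τ * -z = -(2 * τ) * z := by ring
      rw [e]; linarith
  calc |z * (Real.exp (y * z) - 1 - y * z)|
      ≤ |z| * ((y * z) ^ 2 * Real.exp |y * z|) := by
        rw [abs_mul]; gcongr
    _ ≤ Real.exp (τ * |z|) / τ * ((y * z) ^ 2 * Real.exp (τ * |z|)) := by gcongr
    _ = y ^ 2 / τ * z ^ 2 * (Real.exp (τ * |z|) * Real.exp (τ * |z|)) := by ring
    _ ≤ y ^ 2 / τ * z ^ 2 * (Real.exp (2 * τ * z) + Real.exp (-(2 * τ) * z)) := by gcongr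
    _ = _ := by ring

namespace GLM

variable (G : GLM)

/-- The constant of the quadratic remainder bound for the derivative of the cumulant function. -/
def remConst : ℝ := 11 * G.Cdev ^ 2 * Real.exp G.Cdev

lemma remConst_pos : 0 < G.remConst := by
  have := G.Cdev_pos
  rw [remConst]; positivity

/-- The cumulant function of the centred response is a Bregman divergence of a convex function. -/
lemma cumulant_nonneg (η t : ℝ) : 0 ≤ G.cumulant η t :=
  nonneg_of_mul_deriv_nonneg (a := |t|) (G.hasDerivAt_cumulant η) (G.cumulant_zero η)
    (fun s _ => by
      obtain ⟨c, -, e⟩ := G.exists_deriv_b_sub_eq η s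
      rw [e]
      have := G.b''_nonneg (η + c)
      nlinarith [sq_nonneg s]) le_rfl

lemma integral_centred_sq_mul_exp_le (η : ℝ) {s : ℝ} (hs : |s| ≤ 1 / 2)
    (hs2 : G.b'' η * s ^ 2 ≤ 1 / 4) :
    ∫ y, G.centred η y ^ 2 * Real.exp (s * G.centred η y) ∂(G.law η) ≤
      5 / 4 * G.Cdev ^ 2 * Real.exp G.Cdev * G.b'' η := by
  rw [integral_centred_sq_mul_exp]
  have hC := G.one_le_Cdev
  have hv := G.b''_nonneg η
  have h1 := G.b''_add_le η hs
  have h2 := G.cumulant_le η hs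
  have h3 := G.abs_deriv_b_sub_le η hs
  have h4 : (deriv G.b (η + s) - deriv G.b η) ^ 2 ≤ (G.Cdev * G.b'' η * |s|) ^ 2 := by
    rw [← sq_abs]; gcongr
  have h5 : (G.Cdev * G.b'' η * |s|) ^ 2 ≤ G.Cdev ^ 2 * G.b'' η * (1 / 4) := by
    rw [mul_pow, sq_abs]
    have : 0 ≤ G.Cdev ^ 2 * G.b'' η := by positivity
    nlinarith
  have h6 : G.Cdev * G.b'' η ≤ G.Cdev ^ 2 * G.b'' η := by
    gcongr; nlinarith
  have h7 : G.cumulant η s ≤ G.Cdev := by nlinarith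
  calc _ ≤ (5 / 4 * G.Cdev ^ 2 * G.b'' η) * Real.exp G.Cdev := by
        gcongr
        linarith
    _ = _ := by ring

/-- A quadratic Taylor bound for the derivative of the cumulant function. The third derivative need
not be dominated by the second one; the factor `1 + √b''` comes from applying the assumption on
`b''` at the scale `1 / (1 + √b'')`, which bounds the third absolute moment by a multiple of
`(1 + √b'') b''`. -/
lemma abs_deriv_b_sub_sub_le (η : ℝ) {y : ℝ} (hy : |y| ≤ 1 / 2) :
    |deriv G.b (η + y) - deriv G.b η - G.b'' η * y| ≤
      G.remConst * (1 + √(G.b'' η)) * G.b'' η * y ^ 2 := by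
  have hC := G.one_le_Cdev
  have hv := G.b''_nonneg η
  have hsv := Real.sqrt_nonneg (G.b'' η)
  have hvv := Real.sq_sqrt hv
  set v := G.b'' η with hvdef
  set w := √v with hw
  set C := G.Cdev with hCdef
  have hD := G.abs_deriv_b_sub_le η hy
  set D := deriv G.b (η + y) - deriv G.b η with hDdef
  have hE : 1 ≤ Real.exp C := Real.one_le_exp (by linarith)
  have hCC : C ≤ C ^ 2 := by nlinarith
  obtain ⟨τ, hτ⟩ : ∃ τ, τ = 1 / (4 * (1 + w)) := ⟨_, rfl⟩
  have hτ0 : 0 < τ := by rw [hτ]; positivity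
  have hτw : 4 * τ * (1 + w) = 1 := by rw [hτ]; field_simp
  have hτ4 : τ ≤ 1 / 4 := by nlinarith
  have hτw' : τ * w ≤ 1 / 4 := by nlinarith
  rcases le_or_gt |y| τ with h | h
  · -- near zero, expand the first moment of the exponentially tilted centred response
    have hvy : v * y ^ 2 ≤ 1 / 16 := by
      rw [← hvv, ← mul_pow, ← sq_abs, abs_mul, abs_of_nonneg hsv]
      have : w * |y| ≤ 1 / 4 := le_trans (mul_le_mul_of_nonneg_left h hsv) (by linarith)
      have : 0 ≤ w * |y| := by positivity
      nlinarith
    have hint : ∀ s : ℝ, Integrable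
        (fun x => G.centred η x ^ 2 * Real.exp (s * G.centred η x)) (G.law η) :=
      fun s => G.integrable_pow_mul_exp_centred η s 2
    have hW : |D * Real.exp (G.cumulant η y) - v * y| ≤
        10 * (1 + w) * C ^ 2 * Real.exp C * v * y ^ 2 := by
      have e : D * Real.exp (G.cumulant η y) - v * y = ∫ x, G.centred η x *
          (Real.exp (y * G.centred η x) - 1 - y * G.centred η x) ∂(G.law η) := by
        have e1 : ∀ x, G.centred η x *
            (Real.exp (y * G.centred η x) - 1 - y * G.centred η x) =
            G.centred η x * Real.exp (y * G.centred η x) - G.centred η x -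
              y * G.centred η x ^ 2 := fun x => by ring
        have i1 : Integrable (fun x => G.centred η x * Real.exp (y * G.centred η x))
            (G.law η) := by simpa using G.integrable_pow_mul_exp_centred η y 1
        have i2 : Integrable (fun x => G.centred η x ^ 2) (G.law η) := by
          simpa using hint 0
        have i3 : Integrable (fun x => G.centred η x * Real.exp (y * G.centred η x) -
            G.centred η x) (G.law η) := i1.sub (G.integrable_centred η)
        simp only [e1]
        rw [integral_sub i3 (i2.const_mul y),
          integral_sub i1 (G.integrable_centred η), integral_const_mul, integral_centred,
          integral_centred_sq, integral_centred_mul_exp]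
        ring
      have hs : |2 * τ| ≤ 1 / 2 := by rw [abs_of_pos (by positivity)]; linarith
      have hs2 : v * (2 * τ) ^ 2 ≤ 1 / 4 := by
        have : v * (2 * τ) ^ 2 = 4 * (τ * w) ^ 2 := by rw [← hvv]; ring
        have h0 : 0 ≤ τ * w := by positivity
        nlinarith
      have m1 := G.integral_centred_sq_mul_exp_le η hs hs2
      have m2 := G.integral_centred_sq_mul_exp_le η (s := -(2 * τ)) (by rwa [abs_neg])
        (by rwa [neg_sq])
      rw [e]
      calc _ ≤ ∫ x, |G.centred η x *
            (Real.exp (y * G.centred η x) - 1 - y * G.centred η x)| ∂(G.law η) :=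
            abs_integral_le_integral_abs
        _ ≤ ∫ x, y ^ 2 / τ * (G.centred η x ^ 2 * Real.exp (2 * τ * G.centred η x) +
            G.centred η x ^ 2 * Real.exp (-(2 * τ) * G.centred η x)) ∂(G.law η) := by
            apply integral_mono_of_nonneg (ae_of_all _ fun x => abs_nonneg _)
              (((hint _).add (hint _)).const_mul _)
              (ae_of_all _ fun x => abs_mul_exp_sub_le hτ0 h _)
        _ = y ^ 2 / τ * (∫ x, G.centred η x ^ 2 * Real.exp (2 * τ * G.centred η x) ∂(G.law η) +
            ∫ x, G.centred η x ^ 2 * Real.exp (-(2 * τ) * G.centred η x) ∂(G.law η)) := by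
            rw [integral_const_mul, integral_add (hint _) (hint _)]
        _ ≤ y ^ 2 / τ * (5 / 4 * C ^ 2 * Real.exp C * v + 5 / 4 * C ^ 2 * Real.exp C * v) := by
            gcongr
        _ = _ := by
            rw [hτ]; field_simp; ring
    have hc0 := G.cumulant_nonneg η y
    have hc1 := G.cumulant_le η hy
    have hM : Real.exp (G.cumulant η y) - 1 ≤ C * v / 2 * y ^ 2 * Real.exp C := by
      have h1 : Real.exp (G.cumulant η y) - 1 ≤
          G.cumulant η y * Real.exp (G.cumulant η y) := by
        have := Real.add_one_le_exp (-G.cumulant η y)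
        have h2 : Real.exp (G.cumulant η y) * Real.exp (-G.cumulant η y) = 1 := by
          rw [← Real.exp_add]; simp
        nlinarith [Real.exp_pos (G.cumulant η y)]
      have h2 : G.cumulant η y ≤ C := by nlinarith
      refine h1.trans ?_
      gcongr
    have hM0 : 0 ≤ Real.exp (G.cumulant η y) - 1 := by
      linarith [Real.one_le_exp hc0]
    have hDM : |D * (Real.exp (G.cumulant η y) - 1)| ≤
        (1 + w) * C ^ 2 * Real.exp C * v * y ^ 2 := by
      rw [abs_mul, abs_of_nonneg hM0]
      have hvy2 : v * |y| ≤ 1 + w := by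
        have h1 : v * |y| ≤ v * τ := by gcongr
        have h2 : v * τ = w * (τ * w) := by rw [← hvv]; ring
        nlinarith
      calc _ ≤ (C * v * |y|) * (C * v / 2 * y ^ 2 * Real.exp C) := by gcongr
        _ = (v * |y|) * (C ^ 2 * Real.exp C * v * y ^ 2) / 2 := by ring
        _ ≤ (1 + w) * (C ^ 2 * Real.exp C * v * y ^ 2) / 2 := by gcongr
        _ ≤ _ := by
          have : 0 ≤ (1 + w) * C ^ 2 * Real.exp C * v * y ^ 2 := by positivity
          linarith
    have e : D - v * y = (D * Real.exp (G.cumulant η y) - v * y) -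
        D * (Real.exp (G.cumulant η y) - 1) := by ring
    rw [e]
    refine (abs_sub _ _).trans ?_
    rw [remConst]
    linarith
  · -- away from zero, both terms are bounded by multiples of `v * |y|`
    have h1 : |D - v * y| ≤ (C + 1) * v * |y| := by
      refine (abs_sub _ _).trans ?_
      rw [abs_mul, abs_of_nonneg hv]
      linarith
    have h2 : |y| ≤ 4 * (1 + w) * y ^ 2 := by
      rw [← sq_abs]
      have h3 : 1 ≤ 4 * (1 + w) * |y| := by
        rw [← hτw]
        nlinarith
      nlinarith [abs_nonneg y]
    have h3 : 4 * (C + 1) ≤ 11 * C ^ 2 * Real.exp C := by nlinarith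
    calc _ ≤ (C + 1) * v * |y| := h1
      _ ≤ (C + 1) * v * (4 * (1 + w) * y ^ 2) := by gcongr
      _ = 4 * (C + 1) * ((1 + w) * v * y ^ 2) := by ring
      _ ≤ 11 * C ^ 2 * Real.exp C * ((1 + w) * v * y ^ 2) := by gcongr
      _ = _ := by rw [remConst]; ring

end GLM

/-! ### Weighted Gram matrices -/

section Gram

variable {m ι : Type*} [Fintype m] [DecidableEq m] [Fintype ι]

/-- The Gram matrix `Aᵀ W A` for the diagonal matrix `W` of the weights `w`. -/
def weightedGram (A : Matrix m ι ℝ) (w : m → ℝ) : Matrix ι ι ℝ := Aᵀ * Matrix.diagonal w * A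

lemma weightedGram_mulVec (A : Matrix m ι ℝ) (w : m → ℝ) (a : ι → ℝ) (j : ι) :
    (weightedGram A w *ᵥ a) j = ∑ i, A i j * (w i * (A i ⬝ᵥ a)) := by
  rw [weightedGram, ← mulVec_mulVec, ← mulVec_mulVec]
  simp only [mulVec, dotProduct, transpose_apply, diagonal_apply, ite_mul, zero_mul,
    Finset.sum_ite_eq, Finset.mem_univ, if_true]

lemma quad_weightedGram (A : Matrix m ι ℝ) (w : m → ℝ) (a : ι → ℝ) :
    quad (weightedGram A w) a = ∑ i, w i * (A i ⬝ᵥ a) ^ 2 := by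
  have h : ∀ j, a j * (weightedGram A w *ᵥ a) j =
      ∑ i, (w i * (A i ⬝ᵥ a)) * (A i j * a j) := by
    intro j
    rw [weightedGram_mulVec, Finset.mul_sum]
    exact Finset.sum_congr rfl fun i _ => by ring
  rw [quad, dotProduct]
  simp only [h]
  rw [Finset.sum_comm]
  refine Finset.sum_congr rfl fun i _ => ?_
  rw [← Finset.mul_sum]
  simp only [dotProduct]
  ring

lemma quad_weightedGram_smul (A : Matrix m ι ℝ) (w : m → ℝ) (t : ℝ) (a : ι → ℝ) :
    quad (weightedGram A w) (t • a) = t ^ 2 * quad (weightedGram A w) a := by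
  rw [quad_weightedGram, quad_weightedGram, Finset.mul_sum]
  refine Finset.sum_congr rfl fun i _ => ?_
  rw [dotProduct_smul, smul_eq_mul]; ring

lemma posDef_weightedGram {A : Matrix m ι ℝ} {w : m → ℝ}
    (h : ∀ a, a ≠ 0 → 0 < quad (weightedGram A w) a) : (weightedGram A w).PosDef := by
  refine PosDef.of_dotProduct_mulVec_pos ?_ fun a ha => by simpa [quad] using h a ha
  rw [Matrix.IsHermitian, conjTranspose_eq_transpose_of_trivial, weightedGram]
  simp [Matrix.transpose_mul, Matrix.mul_assoc]

end Gram

/-- A positive definite matrix is `Bᵀ B` for an invertible `B`. -/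
lemma exists_factor_of_posDef {ι : Type*} [Fintype ι] [DecidableEq ι] {F : Matrix ι ι ℝ}
    (hF : F.PosDef) : ∃ B : Matrix ι ι ℝ, F = Bᵀ * B ∧ IsUnit B.det := by
  open scoped MatrixOrder in
  obtain ⟨B, hB⟩ := CStarAlgebra.nonneg_iff_eq_star_mul_self.mp hF.posSemidef.nonneg
  rw [star_eq_conjTranspose, conjTranspose_eq_transpose_of_trivial] at hB
  refine ⟨B, hB, ?_⟩
  have h := hF.det_pos
  rw [hB, det_mul, det_transpose] at h
  exact isUnit_iff_ne_zero.2 fun h0 => by simp [h0] at h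

lemma dotProduct_le_sqrt_mul_sqrt {ι : Type*} [Fintype ι] (a b : ι → ℝ) :
    a ⬝ᵥ b ≤ √(∑ i, a i ^ 2) * √(∑ i, b i ^ 2) :=
  Real.sum_mul_le_sqrt_mul_sqrt _ a b

lemma abs_dotProduct_le_sqrt_mul_sqrt {ι : Type*} [Fintype ι] (a b : ι → ℝ) :
    |a ⬝ᵥ b| ≤ √(∑ i, a i ^ 2) * √(∑ i, b i ^ 2) := by
  refine abs_le'.2 ⟨dotProduct_le_sqrt_mul_sqrt a b, ?_⟩
  simpa using dotProduct_le_sqrt_mul_sqrt (-a) b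

/-! ### Deviations of the score -/

/-- A finite subset of a ball that computes the Euclidean norm up to a factor two: the points of a
cubic grid of mesh `1 / (2 s)` in dimension `s`. -/
lemma exists_finite_norming_set (ι : Type*) [Fintype ι] [Nonempty ι] :
    ∃ N : Finset (ι → ℝ), N.card ≤ (4 * Fintype.card ι + 1) ^ Fintype.card ι ∧
      (∀ v ∈ N, ∑ j, v j ^ 2 ≤ 4) ∧
      ∀ (z : ι → ℝ) (u : ℝ), (∀ v ∈ N, v ⬝ᵥ z ≤ u) → √(∑ j, z j ^ 2) ≤ 2 * u := by
  classical
  set s := Fintype.card ι with hs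
  have hs1 : 1 ≤ s := Fintype.card_pos
  have hsR : (1 : ℝ) ≤ s := by exact_mod_cast hs1
  set m : ℝ := 2 * s with hm
  have hm0 : 0 < m := by positivity
  -- rounding down to the grid moves a unit vector by at most `√s / m ≤ 1 / 2`
  let K : Finset (ι → ℤ) := Fintype.piFinset fun _ => Finset.Icc (-(2 * s : ℤ)) (2 * s)
  let f : (ι → ℤ) → ι → ℝ := fun k j => k j / m
  refine ⟨(K.image f).filter fun v => ∑ j, v j ^ 2 ≤ 4, ?_, fun v hv => (Finset.mem_filter.1 hv).2,
    ?_⟩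
  · refine (Finset.card_filter_le _ _).trans (Finset.card_image_le.trans ?_)
    simp only [K]
    rw [Fintype.card_piFinset, Finset.prod_const, Finset.card_univ, Int.card_Icc]
    apply le_of_eq
    congr 1
    omega
  · intro z u h
    rcases eq_or_ne z 0 with rfl | hz
    · have := h 0 (by
        refine Finset.mem_filter.2 ⟨Finset.mem_image.2 ⟨0, ?_, ?_⟩, by simp⟩
        · simp [K]
        · ext j; simp [f])
      simp at this
      simpa using this
    set r := √(∑ j, z j ^ 2) with hr
    have hr2 : r ^ 2 = ∑ j, z j ^ 2 := Real.sq_sqrt (Finset.sum_nonneg fun j _ => sq_nonneg _)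
    have hr0 : 0 < r := by
      obtain ⟨j, hj⟩ := Function.ne_iff.1 hz
      refine Real.sqrt_pos.2 (Finset.sum_pos' (fun j _ => sq_nonneg _) ⟨j, Finset.mem_univ _, ?_⟩)
      exact sq_pos_of_ne_zero hj
    let x : ι → ℝ := fun j => z j / r
    have hx2 : ∑ j, x j ^ 2 = 1 := by
      simp only [x, div_pow]
      rw [← Finset.sum_div, ← hr2, div_self (by positivity)]
    have hx1 : ∀ j, |x j| ≤ 1 := by
      intro j
      have : x j ^ 2 ≤ 1 := by
        rw [← hx2]
        exact Finset.single_le_sum (f := fun j => x j ^ 2) (fun j _ => sq_nonneg _)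
          (Finset.mem_univ j)
      exact (sq_le_one_iff_abs_le_one _).1 this
    let k : ι → ℤ := fun j => ⌊x j * m⌋
    have hd : ∀ j, (f k j - x j) ^ 2 ≤ (1 / m) ^ 2 := by
      intro j
      have h1 := Int.floor_le (x j * m)
      have h2 := Int.lt_floor_add_one (x j * m)
      have e : f k j - x j = ((⌊x j * m⌋ : ℝ) - x j * m) / m := by
        simp only [f, k]; field_simp
      rw [e, div_pow, div_pow, one_pow]
      gcongr
      nlinarith
    have hdsum : ∑ j, (f k j - x j) ^ 2 ≤ 1 / 4 := by
      calc _ ≤ ∑ _j : ι, (1 / m) ^ 2 := Finset.sum_le_sum fun j _ => hd j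
        _ = s * (1 / m) ^ 2 := by simp [hs]
        _ = 1 / (4 * s) := by rw [hm]; field_simp; norm_num
        _ ≤ 1 / 4 := by gcongr; linarith
    have hmem := h (f k) (by
      refine Finset.mem_filter.2 ⟨Finset.mem_image_of_mem _ ?_, ?_⟩
      · refine Fintype.mem_piFinset.2 fun j => Finset.mem_Icc.2 ⟨?_, ?_⟩
        · apply Int.le_floor.2
          push_cast
          have := (abs_le.1 (hx1 j)).1
          rw [hm] at *; nlinarith
        · have h1 := Int.floor_le (x j * m)
          have h2 := (abs_le.1 (hx1 j)).2
          have : ((k j : ℤ) : ℝ) ≤ ((2 * s : ℤ) : ℝ) := by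
            push_cast
            simp only [k]
            rw [hm] at *; nlinarith
          exact_mod_cast this
      · calc ∑ j, f k j ^ 2 ≤ ∑ j, (2 * x j ^ 2 + 2 * (f k j - x j) ^ 2) := by
              refine Finset.sum_le_sum fun j _ => ?_
              nlinarith [sq_nonneg (f k j - 2 * x j)]
          _ = 2 * 1 + 2 * ∑ j, (f k j - x j) ^ 2 := by
              rw [Finset.sum_add_distrib, ← Finset.mul_sum, ← Finset.mul_sum, hx2]
          _ ≤ 4 := by linarith)
    have hxz : x ⬝ᵥ z = r := by
      simp only [dotProduct, x]
      have : ∀ j, z j / r * z j = z j ^ 2 / r := fun j => by ring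
      simp only [this]
      rw [← Finset.sum_div, ← hr2]
      field_simp
    have hcs := (abs_le.1 (abs_dotProduct_le_sqrt_mul_sqrt (f k - x) z)).1
    have hsq : √(∑ j, (f k - x) j ^ 2) ≤ 1 / 2 := by
      rw [Real.sqrt_le_left (by norm_num)]
      simpa using hdsum.trans (by norm_num)
    rw [sub_dotProduct, hxz, ← hr] at hcs
    nlinarith

section Chernoff

variable (G : GLM) {n : ℕ}

/-- The Chernoff bound for linear combinations of the centred responses. -/
lemma measureReal_le_sum_centred_le (η c : Fin n → ℝ) (hc : ∀ i, |c i| ≤ 1 / 2) (u : ℝ) :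
    (Measure.pi fun i => G.law (η i)).real {y | u ≤ ∑ i, c i * G.centred (η i) (y i)} ≤
      Real.exp (-u + G.Cdev / 2 * ∑ i, G.b'' (η i) * c i ^ 2) := by
  have hexp : ∀ y : Fin n → ℝ, Real.exp (1 * ∑ i, c i * G.centred (η i) (y i)) =
      ∏ i, Real.exp (c i * G.centred (η i) (y i)) := fun y => by rw [one_mul, Real.exp_sum]
  have hint : Integrable (fun y : Fin n → ℝ => Real.exp (1 * ∑ i, c i * G.centred (η i) (y i)))
      (Measure.pi fun i => G.law (η i)) := by
    simp only [hexp]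
    exact Integrable.fintype_prod (f := fun i x => Real.exp (c i * G.centred (η i) x))
      fun i => G.integrable_exp_centred (η i) (c i)
  refine (measure_ge_le_exp_mul_mgf u zero_le_one hint).trans ?_
  rw [mgf]
  simp only [hexp]
  rw [integral_fintype_prod_eq_prod (f := fun i x => Real.exp (c i * G.centred (η i) x))]
  have h1 : ∀ i, ∫ x, Real.exp (c i * G.centred (η i) x) ∂(G.law (η i)) =
      Real.exp (G.cumulant (η i) (c i)) := fun i => G.mgf_centred (η i) (c i)
  simp only [h1]
  rw [← Real.exp_sum, ← Real.exp_add]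
  apply Real.exp_le_exp.2
  rw [Finset.mul_sum]
  have : ∑ i, G.cumulant (η i) (c i) ≤ ∑ i, G.Cdev / 2 * (G.b'' (η i) * c i ^ 2) :=
    Finset.sum_le_sum fun i _ => (G.cumulant_le (η i) (hc i)).trans (le_of_eq (by ring))
  linarith

lemma measurable_sum_centred (η c : Fin n → ℝ) :
    Measurable fun y : Fin n → ℝ => ∑ i, c i * G.centred (η i) (y i) := by
  unfold GLM.centred
  fun_prop

/-- The score of a model, measured in the norm dual to the one of the Fisher information, is
controlled by a union bound over a finite norming set. -/
lemma exists_event_score_le {ι : Type*} [Fintype ι] [DecidableEq ι] [Nonempty ι]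
    (A : Matrix (Fin n) ι ℝ) (η : Fin n → ℝ)
    (hpos : ∀ a, a ≠ 0 → 0 < quad (weightedGram A fun i => G.b'' (η i)) a) {t : ℝ}
    (ht : ∀ a, quad (weightedGram A fun i => G.b'' (η i)) a ≤ 4 → ∀ i, |t * (A i ⬝ᵥ a)| ≤ 1 / 2)
    (ht0 : 0 ≤ t) (u : ℝ) :
    ∃ E : Set (Fin n → ℝ), MeasurableSet E ∧
      (Measure.pi fun i => G.law (η i)).real Eᶜ ≤
        (4 * Fintype.card ι + 1 : ℝ) ^ Fintype.card ι * Real.exp (-(t * u) + 2 * G.Cdev * t ^ 2) ∧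
      ∀ y ∈ E, ∀ a, ∑ i, (A i ⬝ᵥ a) * G.centred (η i) (y i) ≤
        2 * u * √(quad (weightedGram A fun i => G.b'' (η i)) a) := by
  set F := weightedGram A fun i => G.b'' (η i) with hF
  obtain ⟨N, hN, hN4, hNn⟩ := exists_finite_norming_set ι
  obtain ⟨B, hB, hBu⟩ := exists_factor_of_posDef (posDef_weightedGram hpos)
  have hquad : ∀ a, quad F a = ∑ j, (B *ᵥ a) j ^ 2 := by
    intro a
    rw [quad, hF, hB, ← mulVec_mulVec, dotProduct_mulVec, vecMul_transpose]
    simp only [dotProduct, sq]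
  have hBB : ∀ v, B *ᵥ (B⁻¹ *ᵥ v) = v := fun v => by
    rw [mulVec_mulVec, mul_nonsing_inv _ hBu, one_mulVec]
  have hBB' : ∀ v, B⁻¹ *ᵥ (B *ᵥ v) = v := fun v => by
    rw [mulVec_mulVec, nonsing_inv_mul _ hBu, one_mulVec]
  let bad : (ι → ℝ) → Set (Fin n → ℝ) := fun v =>
    {y | t * u ≤ ∑ i, (t * (A i ⬝ᵥ (B⁻¹ *ᵥ v))) * G.centred (η i) (y i)}
  let good : (ι → ℝ) → Set (Fin n → ℝ) := fun v =>
    {y | ∑ i, (A i ⬝ᵥ (B⁻¹ *ᵥ v)) * G.centred (η i) (y i) ≤ u}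
  refine ⟨⋂ v ∈ N, good v, ?_, ?_, ?_⟩
  · exact Finset.measurableSet_biInter _ fun v _ =>
      measurableSet_le (measurable_sum_centred G η _) measurable_const
  · have hsub : (⋂ v ∈ N, good v)ᶜ ⊆ ⋃ v ∈ N, bad v := by
      intro y hy
      simp only [Set.mem_compl_iff, Set.mem_iInter, not_forall] at hy
      obtain ⟨v, hv, hy⟩ := hy
      refine Set.mem_biUnion hv ?_
      simp only [good, Set.mem_ofPred_eq, not_le] at hy
      simp only [bad, Set.mem_ofPred_eq, mul_assoc]
      rw [← Finset.mul_sum]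
      gcongr
    refine (measureReal_mono hsub (measure_ne_top _ _)).trans ((measureReal_biUnion_finset_le _ _).trans ?_)
    have hb : ∀ v ∈ N, (Measure.pi fun i => G.law (η i)).real (bad v) ≤
        Real.exp (-(t * u) + 2 * G.Cdev * t ^ 2) := by
      intro v hv
      have hq : quad F (B⁻¹ *ᵥ v) ≤ 4 := by
        rw [hquad, hBB]; exact hN4 v hv
      refine (measureReal_le_sum_centred_le G η _ (ht _ hq) _).trans ?_
      apply Real.exp_le_exp.2
      have e : ∑ i, G.b'' (η i) * (t * (A i ⬝ᵥ (B⁻¹ *ᵥ v))) ^ 2 =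
          t ^ 2 * quad F (B⁻¹ *ᵥ v) := by
        rw [hF, quad_weightedGram, Finset.mul_sum]
        exact Finset.sum_congr rfl fun i _ => by ring
      rw [e]
      have : G.Cdev / 2 * (t ^ 2 * quad F (B⁻¹ *ᵥ v)) ≤ G.Cdev / 2 * (t ^ 2 * 4) := by
        have := G.Cdev_pos
        gcongr
      linarith
    refine (Finset.sum_le_sum hb).trans ?_
    rw [Finset.sum_const, nsmul_eq_mul]
    gcongr
    exact_mod_cast hN
  · intro y hy a
    set g : ι → ℝ := fun j => ∑ i, A i j * G.centred (η i) (y i) with hg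
    have hlin : ∀ a, ∑ i, (A i ⬝ᵥ a) * G.centred (η i) (y i) = a ⬝ᵥ g := by
      intro a
      simp only [dotProduct, hg, Finset.mul_sum, Finset.sum_mul]
      rw [Finset.sum_comm]
      exact Finset.sum_congr rfl fun j _ => Finset.sum_congr rfl fun i _ => by ring
    have hz : ∀ v, (B⁻¹ *ᵥ v) ⬝ᵥ g = v ⬝ᵥ ((B⁻¹)ᵀ *ᵥ g) := fun v => by
      rw [dotProduct_mulVec, vecMul_transpose]
    have h1 := hNn ((B⁻¹)ᵀ *ᵥ g) u fun v hv => by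
      rw [← hz, ← hlin]
      simp only [Set.mem_iInter] at hy
      exact hy v hv
    rw [hlin, hquad]
    have h2 := dotProduct_le_sqrt_mul_sqrt (B *ᵥ a) ((B⁻¹)ᵀ *ᵥ g)
    rw [← hz, hBB'] at h2
    refine h2.trans ?_
    rw [mul_comm]
    gcongr

end Chernoff

/-! ### Likelihood maximization in a fixed model -/

lemma GLM.cumulant_pos (G : GLM) (η : ℝ) {t : ℝ} (ht : t ≠ 0) : 0 < G.cumulant η t := by
  have h1 := G.strictConvex_b.2 (Set.mem_univ η) (Set.mem_univ (η + t)) (by simpa using ht)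
    (show (0 : ℝ) < 1 / 2 by norm_num) (show (0 : ℝ) < 1 / 2 by norm_num) (by norm_num)
  have h2 := G.cumulant_nonneg η (t / 2)
  simp only [smul_eq_mul] at h1
  have e : 1 / 2 * η + 1 / 2 * (η + t) = η + t / 2 := by ring
  rw [e] at h1
  simp only [GLM.cumulant] at *
  linarith

section FixedModel

variable (G : GLM) {n p : ℕ} (X : Matrix (Fin n) (Fin p) ℝ) (S : Finset (Fin p))

lemma linPred_add (θ a : S → ℝ) (i : Fin n) :
    linPred X S (θ + a) i = linPred X S θ i + colSub X S i ⬝ᵥ a := by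
  rw [linPred, dotProduct_add, linPred]

lemma fisher_eq_weightedGram (θ : S → ℝ) :
    fisher G X S θ = weightedGram (colSub X S) fun i => G.b'' (linPred X S θ i) := rfl

/-- The exact expansion of the log-likelihood around a point. -/
lemma logLik_add (θ a : S → ℝ) (y : Fin n → ℝ) :
    logLik G X S (θ + a) y = logLik G X S θ y +
      ∑ i, (colSub X S i ⬝ᵥ a) * G.centred (linPred X S θ i) (y i) -
      ∑ i, G.cumulant (linPred X S θ i) (colSub X S i ⬝ᵥ a) := by
  rw [logLik, logLik, ← Finset.sum_add_distrib, ← Finset.sum_sub_distrib]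
  refine Finset.sum_congr rfl fun i _ => ?_
  rw [linPred_add, GLM.centred, GLM.cumulant]
  ring

variable {G X S}

lemma exists_dotProduct_ne_zero {θ a : S → ℝ}
    (hpos : ∀ a, a ≠ 0 → 0 < quad (fisher G X S θ) a) (ha : a ≠ 0) :
    ∃ i, colSub X S i ⬝ᵥ a ≠ 0 := by
  by_contra! h
  have := hpos a ha
  rw [fisher_eq_weightedGram, quad_weightedGram] at this
  simp [h] at this

lemma strictConcaveOn_logLik {θ₁ : S → ℝ}
    (hpos : ∀ a, a ≠ 0 → 0 < quad (fisher G X S θ₁) a) (y : Fin n → ℝ) :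
    StrictConcaveOn ℝ Set.univ fun θ => logLik G X S θ y := by
  refine ⟨convex_univ, fun θ _ θ' _ hne s t hs ht hst => ?_⟩
  have hlin : ∀ i, linPred X S (s • θ + t • θ') i =
      s * linPred X S θ i + t * linPred X S θ' i := by
    intro i
    simp [linPred, dotProduct_add, dotProduct_smul]
  obtain ⟨i, hi⟩ := exists_dotProduct_ne_zero hpos (sub_ne_zero.2 hne)
  have hi' : linPred X S θ i ≠ linPred X S θ' i := by
    rw [dotProduct_sub] at hi
    exact sub_ne_zero.1 hi
  simp only [logLik, smul_eq_mul, Finset.mul_sum]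
  rw [← Finset.sum_add_distrib]
  have hk : ∀ i, G.k (y i) = s * G.k (y i) + t * G.k (y i) := fun i => by rw [← add_mul, hst, one_mul]
  refine Finset.sum_lt_sum (fun j _ => ?_) ⟨i, Finset.mem_univ i, ?_⟩
  · have h := G.strictConvex_b.convexOn.2 (Set.mem_univ (linPred X S θ j))
      (Set.mem_univ (linPred X S θ' j)) hs.le ht.le hst
    simp only [smul_eq_mul] at h
    rw [hlin]
    linarith [hk j]
  · have h := G.strictConvex_b.2 (Set.mem_univ (linPred X S θ i))
      (Set.mem_univ (linPred X S θ' i)) hi' hs ht hst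
    simp only [smul_eq_mul] at h
    rw [hlin]
    linarith [hk i]

lemma continuous_logLik (y : Fin n → ℝ) : Continuous fun θ => logLik G X S θ y := by
  have hb := G.continuous_b
  have hl : ∀ i, Continuous fun θ : S → ℝ => linPred X S θ i := fun i => by
    simp only [linPred, dotProduct]
    fun_prop
  simp only [logLik]
  fun_prop

lemma continuous_quad {ι : Type*} [Fintype ι] (F : Matrix ι ι ℝ) : Continuous (quad F) := by
  unfold quad
  simp only [dotProduct, mulVec]
  fun_prop

/-- If the score at `θs` is small compared with the radius `r` of an ellipsoid around `θs` on which
the linear predictor hardly varies, then the likelihood on the boundary of the ellipsoid and,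
by concavity, outside it stays below its value at `θs`; so the ellipsoid contains the
unique maximizer. -/
lemma existsUnique_mle_of_score_le {θs : S → ℝ} {y : Fin n → ℝ} {c u r : ℝ} (hc : 0 < c)
    (hF : ∀ a, c * ∑ j, a j ^ 2 ≤ quad (fisher G X S θs) a) (hu : 0 ≤ u)
    (hscore : ∀ a, ∑ i, (colSub X S i ⬝ᵥ a) * G.centred (linPred X S θs i) (y i) ≤
      u * √(quad (fisher G X S θs) a))
    (hr : 2 * G.Cdev * u < r)
    (hsmall : ∀ a, quad (fisher G X S θs) a ≤ r ^ 2 → ∀ i, |colSub X S i ⬝ᵥ a| ≤ 1 / 2) :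
    (∃! θ, IsMLE G X S y θ) ∧
      ∀ θ, IsMLE G X S y θ → quad (fisher G X S θs) (θ - θs) ≤ r ^ 2 := by
  have hC := G.Cdev_pos
  have hr0 : 0 < r := lt_of_le_of_lt (by positivity) hr
  set F := fisher G X S θs with hFdef
  have hpos : ∀ a, a ≠ 0 → 0 < quad F a := fun a ha => by
    obtain ⟨j, hj⟩ := Function.ne_iff.1 ha
    exact lt_of_lt_of_le (mul_pos hc (Finset.sum_pos' (fun j _ => sq_nonneg _)
      ⟨j, Finset.mem_univ _, sq_pos_of_ne_zero hj⟩)) (hF a)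
  have hconc := strictConcaveOn_logLik hpos y
  -- on the boundary the quadratic decrease exceeds the linear gain
  have hbd : ∀ a, quad F a = r ^ 2 → logLik G X S (θs + a) y < logLik G X S θs y := by
    intro a ha
    have h1 := hscore a
    rw [ha, Real.sqrt_sq hr0.le] at h1
    have h2 : r ^ 2 / (2 * G.Cdev) ≤
        ∑ i, G.cumulant (linPred X S θs i) (colSub X S i ⬝ᵥ a) := by
      rw [← ha, hFdef, fisher_eq_weightedGram, quad_weightedGram, Finset.sum_div]
      refine Finset.sum_le_sum fun i _ => ?_
      refine le_trans (le_of_eq ?_) (G.le_cumulant _ (hsmall a ha.le i))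
      ring
    have h3 : u * r < r ^ 2 / (2 * G.Cdev) := by
      rw [lt_div_iff₀ (by positivity)]
      nlinarith
    rw [logLik_add]
    linarith
  -- outside, compare with the point of the segment to `θs` that lies on the boundary
  have hout : ∀ θ, r ^ 2 < quad F (θ - θs) → logLik G X S θ y < logLik G X S θs y := by
    intro θ hθ
    set q := quad F (θ - θs) with hq
    have hq0 : 0 < q := lt_of_le_of_lt (sq_nonneg r) hθ
    have hqr : r < √q := Real.lt_sqrt_of_sq_lt hθ
    obtain ⟨t, ht⟩ : ∃ t, t = r / √q := ⟨_, rfl⟩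
    have ht0 : 0 < t := by rw [ht]; positivity
    have ht1 : t < 1 := by rw [ht, div_lt_one (by positivity)]; exact hqr
    have hqt : quad F (t • (θ - θs)) = r ^ 2 := by
      rw [hFdef, fisher_eq_weightedGram, quad_weightedGram_smul, ← fisher_eq_weightedGram, ← hFdef,
        ← hq, ht, div_pow, Real.sq_sqrt hq0.le]
      field_simp
    have h1 := hbd _ hqt
    have h2 := hconc.concaveOn.2 (Set.mem_univ θs) (Set.mem_univ θ) (sub_nonneg.2 ht1.le) ht0.le
      (sub_add_cancel 1 t)
    have e : (1 - t) • θs + t • θ = θs + t • (θ - θs) := by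
      ext j; simp; ring
    simp only [e, smul_eq_mul] at h2
    by_contra! h3
    nlinarith
  have hin : ∀ θ, IsMLE G X S y θ → quad F (θ - θs) ≤ r ^ 2 := fun θ hθ => by
    by_contra! h
    exact absurd (hθ θs) (not_le.2 (hout θ h))
  refine ⟨?_, hin⟩
  let K : Set (S → ℝ) := {θ | quad F (θ - θs) ≤ r ^ 2}
  have hKc : IsCompact K := by
    refine Metric.isCompact_of_isClosed_isBounded ?_ ?_
    · exact isClosed_le ((continuous_quad F).comp (continuous_id.sub continuous_const))
        continuous_const
    · refine (Metric.isBounded_closedBall (x := θs) (r := r / √c)).subset fun θ hθ => ?_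
      rw [Metric.mem_closedBall, dist_pi_le_iff (by positivity)]
      intro j
      rw [Real.dist_eq, le_div_iff₀ (by positivity), ← Real.sqrt_sq_eq_abs,
        ← Real.sqrt_mul (sq_nonneg _)]
      refine Real.sqrt_le_iff.2 ⟨hr0.le, ?_⟩
      refine le_trans ?_ ((hF (θ - θs)).trans hθ)
      rw [mul_comm]
      refine mul_le_mul_of_nonneg_left ?_ hc.le
      exact Finset.single_le_sum (f := fun j => (θ - θs) j ^ 2) (fun j _ => sq_nonneg _)
        (Finset.mem_univ j)
  have hmem : θs ∈ K := by
    simp only [K, Set.mem_ofPred_eq, sub_self]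
    simp [quad]; positivity
  obtain ⟨θ, -, hθmax⟩ := hKc.exists_isMaxOn ⟨θs, hmem⟩ (continuous_logLik y).continuousOn
  have hmle : IsMLE G X S y θ := fun θ' => by
    by_cases h : quad F (θ' - θs) ≤ r ^ 2
    · exact hθmax h
    · exact (hout θ' (not_le.1 h)).le.trans (hθmax hmem)
  refine ⟨θ, hmle, fun θ' hθ' => ?_⟩
  exact hconc.eq_of_isMaxOn (fun x _ => hθ' x) (fun x _ => hmle x) (Set.mem_univ _) (Set.mem_univ _)

/-- The likelihood equations. -/
lemma IsMLE.score_eq_zero {θ : S → ℝ} {y : Fin n → ℝ} (h : IsMLE G X S y θ) (j : S) :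
    ∑ i, X i j * (y i - deriv G.b (linPred X S θ i)) = 0 := by
  have hlin : ∀ (t : ℝ) (i : Fin n),
      linPred X S (θ + t • Pi.single j 1) i = linPred X S θ i + t * X i j := by
    intro t i
    rw [linPred_add, dotProduct_smul, dotProduct_single]
    simp [colSub]
  have hd : HasDerivAt (fun t : ℝ => logLik G X S (θ + t • Pi.single j 1) y)
      (∑ i, X i j * (y i - deriv G.b (linPred X S θ i))) 0 := by
    simp only [logLik, hlin]
    refine HasDerivAt.fun_sum fun i _ => ?_
    have h1 : HasDerivAt (fun t : ℝ => linPred X S θ i + t * X i j) (X i j) 0 := by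
      simpa using ((hasDerivAt_id (0 : ℝ)).mul_const (X i j)).const_add (linPred X S θ i)
    have h2 : HasDerivAt (fun t : ℝ => G.b (linPred X S θ i + t * X i j))
        (deriv G.b (linPred X S θ i) * X i j) 0 := by
      have h3 := G.hasDerivAt_b (linPred X S θ i + 0 * X i j)
      have h4 := h3.comp (0 : ℝ) h1
      exact h4.congr_deriv (by simp)
    exact (((h1.const_mul (y i)).sub h2).add_const (G.k (y i))).congr_deriv (by ring)
  have hmax : IsLocalMax (fun t : ℝ => logLik G X S (θ + t • Pi.single j 1) y) 0 := by
    refine Filter.Eventually.of_forall fun t => ?_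
    simpa using h (θ + t • Pi.single j 1)
  exact hmax.hasDerivAt_eq_zero hd

lemma abs_le_rowSumNorm_mul {ι : Type*} [Fintype ι] (A : Matrix ι ι ℝ) {v : ι → ℝ} {T : ℝ}
    (hv : ∀ k, |v k| ≤ T) (j : ι) : |(A *ᵥ v) j| ≤ rowSumNorm A * T := by
  have hT : 0 ≤ T := (abs_nonneg _).trans (hv j)
  calc |(A *ᵥ v) j| ≤ ∑ k, |A j k * v k| := Finset.abs_sum_le_sum_abs _ _
    _ ≤ ∑ k, |A j k| * T := Finset.sum_le_sum fun k _ => by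
        rw [abs_mul]; exact mul_le_mul_of_nonneg_left (hv k) (abs_nonneg _)
    _ = (∑ k, |A j k|) * T := by rw [Finset.sum_mul]
    _ ≤ rowSumNorm A * T := by
        refine mul_le_mul_of_nonneg_right ?_ hT
        exact le_ciSup (f := fun i => ∑ k, |A i k|) (Set.finite_range _).bddAbove j

/-- One Newton step from `θs` approximates the maximum likelihood estimate in the maximum norm, the
remainder of the likelihood equations being quadratic in the estimation error. -/
lemma IsMLE.abs_sub_le {θ θs : S → ℝ} {y : Fin n → ℝ} (h : IsMLE G X S y θ)
    (hdet : IsUnit (fisher G X S θs).det) {r M σ T : ℝ}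
    (hq : quad (fisher G X S θs) (θ - θs) ≤ r ^ 2)
    (hsmall : ∀ i, |colSub X S i ⬝ᵥ (θ - θs)| ≤ 1 / 2)
    (hM : ∀ i j, |X i j| ≤ M) (hσ : ∀ i, √(G.b'' (linPred X S θs i)) ≤ σ)
    (hT : ∀ j : S, |∑ i, X i j * G.centred (linPred X S θs i) (y i)| ≤ T) (j : S) :
    |θ j - θs j| ≤ rowSumNorm (fisher G X S θs)⁻¹ *
      (T + M * (G.remConst * (1 + σ)) * r ^ 2) := by
  set a := θ - θs with ha
  have hθ : θ = θs + a := by rw [ha]; abel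
  set x : Fin n → ℝ := fun i => colSub X S i ⬝ᵥ a with hx
  have hL := G.remConst_pos
  have hFa : ∀ k : S, (fisher G X S θs *ᵥ a) k =
      ∑ i, X i k * G.centred (linPred X S θs i) (y i) -
        ∑ i, X i k * (deriv G.b (linPred X S θs i + x i) - deriv G.b (linPred X S θs i) -
          G.b'' (linPred X S θs i) * x i) := by
    intro k
    have h0 := h.score_eq_zero k
    rw [fisher_eq_weightedGram, weightedGram_mulVec, ← add_zero (∑ i, _), ← h0,
      ← Finset.sum_add_distrib, ← Finset.sum_sub_distrib]
    refine Finset.sum_congr rfl fun i _ => ?_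
    rw [hθ, linPred_add, GLM.centred]
    simp only [hx, colSub, submatrix_apply, id]
    ring
  have hR : ∀ k : S, |∑ i, X i k * (deriv G.b (linPred X S θs i + x i) -
      deriv G.b (linPred X S θs i) - G.b'' (linPred X S θs i) * x i)| ≤
        M * (G.remConst * (1 + σ)) * r ^ 2 := by
    intro k
    calc _ ≤ ∑ i, M * (G.remConst * (1 + σ)) * (G.b'' (linPred X S θs i) * x i ^ 2) := by
          refine (Finset.abs_sum_le_sum_abs _ _).trans (Finset.sum_le_sum fun i _ => ?_)
          rw [abs_mul]
          have h1 := G.abs_deriv_b_sub_sub_le (linPred X S θs i) (hsmall i)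
          have h2 := G.b''_nonneg (linPred X S θs i)
          have h3 := hσ i
          have h4 : 0 ≤ M := (abs_nonneg _).trans (hM i k)
          calc _ ≤ M * (G.remConst * (1 + √(G.b'' (linPred X S θs i))) *
                G.b'' (linPred X S θs i) * x i ^ 2) :=
                mul_le_mul (hM i k) h1 (abs_nonneg _) h4
            _ ≤ M * (G.remConst * (1 + σ) * G.b'' (linPred X S θs i) * x i ^ 2) := by gcongr
            _ = _ := by ring
      _ = M * (G.remConst * (1 + σ)) * quad (fisher G X S θs) a := by
          rw [fisher_eq_weightedGram, quad_weightedGram, Finset.mul_sum]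
      _ ≤ _ := by
          -- without observations `M` and `σ` may be negative, but the Fisher information is singular
          rcases isEmpty_or_nonempty (Fin n) with hn | ⟨⟨i⟩⟩
          · rw [fisher_eq_weightedGram, quad_weightedGram] at *
            have hdet0 : (fisher G X S θs).det ≠ 0 := hdet.ne_zero
            have hz : fisher G X S θs = 0 := by
              ext k l
              simp [fisher, Matrix.mul_apply]
            have : Nonempty S := ⟨k⟩
            exact absurd (by rw [hz, Matrix.det_zero]) hdet0
          · have h4 : 0 ≤ M := (abs_nonneg _).trans (hM i k)
            have h5 : 0 ≤ σ := (Real.sqrt_nonneg _).trans (hσ i)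
            gcongr
  have e : θ j - θs j = ((fisher G X S θs)⁻¹ *ᵥ (fisher G X S θs *ᵥ a)) j := by
    rw [mulVec_mulVec, nonsing_inv_mul _ hdet, one_mulVec, ha, Pi.sub_apply]
  rw [e]
  refine abs_le_rowSumNorm_mul _ (fun k => ?_) j
  rw [hFa]
  exact (abs_sub _ _).trans (add_le_add (hT k) (hR k))

end FixedModel

/-! ### The best approximation in a model containing the true one -/

section Best

variable (G : GLM) {n p : ℕ} (X : Matrix (Fin n) (Fin p) ℝ) {S : Finset (Fin p)}
  (θ₀ : Fin p → ℝ)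

instance isProbabilityMeasure_jointLaw : IsProbabilityMeasure (jointLaw G X θ₀) := by
  unfold jointLaw
  infer_instance

lemma linPred_restrict (hS : supp θ₀ ⊆ S) (i : Fin n) :
    linPred X S (fun j => θ₀ j) i = X i ⬝ᵥ θ₀ := by
  have h : linPred X S (fun j => θ₀ j) i = ∑ j ∈ S, X i j * θ₀ j := by
    rw [← Finset.sum_coe_sort S fun j => X i j * θ₀ j]
    rfl
  rw [h, dotProduct]
  refine Finset.sum_subset (Finset.subset_univ S) fun j _ hj => ?_
  have : θ₀ j = 0 := by
    by_contra h0
    exact hj (hS (Finset.mem_filter.2 ⟨Finset.mem_univ _, h0⟩))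
  rw [this, mul_zero]

/-- The expected log-likelihood ratio with respect to the truth is a sum of Bregman divergences of
the cumulant function. -/
lemma integral_logLik_sub (θ θ' : S → ℝ) :
    ∫ y, (logLik G X S θ' y - logLik G X S θ y) ∂(jointLaw G X θ₀) =
      ∑ i, G.cumulant (X i ⬝ᵥ θ₀) (linPred X S θ i - X i ⬝ᵥ θ₀) -
        ∑ i, G.cumulant (X i ⬝ᵥ θ₀) (linPred X S θ' i - X i ⬝ᵥ θ₀) := by
  have h : ∀ y, logLik G X S θ' y - logLik G X S θ y =
      ∑ i, ((linPred X S θ' i - linPred X S θ i) * y i -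
        (G.b (linPred X S θ' i) - G.b (linPred X S θ i))) := by
    intro y
    rw [logLik, logLik, ← Finset.sum_sub_distrib]
    exact Finset.sum_congr rfl fun i _ => by ring
  have hint : ∀ i, Integrable (fun y : Fin n → ℝ => y i) (jointLaw G X θ₀) := fun i =>
    integrable_comp_eval (μ := fun i => G.law (X i ⬝ᵥ θ₀)) (f := fun y : ℝ => y)
      (G.integrable_id_law _)
  have hval : ∀ i, ∫ y, y i ∂(jointLaw G X θ₀) = deriv G.b (X i ⬝ᵥ θ₀) := fun i => by
    rw [← G.integral_id_law]
    exact integral_comp_eval (μ := fun i => G.law (X i ⬝ᵥ θ₀)) (f := fun y : ℝ => y)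
      (by fun_prop)
  simp only [h]
  have hint' : ∀ i ∈ Finset.univ, Integrable (fun y : Fin n → ℝ =>
      (linPred X S θ' i - linPred X S θ i) * y i -
        (G.b (linPred X S θ' i) - G.b (linPred X S θ i))) (jointLaw G X θ₀) :=
    fun i _ => ((hint i).const_mul _).sub (integrable_const _)
  rw [integral_finsetSum _ hint', ← Finset.sum_sub_distrib]
  refine Finset.sum_congr rfl fun i _ => ?_
  rw [integral_sub ((hint i).const_mul _) (integrable_const _), integral_const_mul, hval,
    integral_const]
  simp [GLM.cumulant]
  ring

/-- In a model that contains the true one, the expected log-likelihood is maximized at the truth. -/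
lemma best_eq_restrict (hS : supp θ₀ ⊆ S)
    (hpos : ∀ a, a ≠ 0 → 0 < quad (fisher G X S fun j => θ₀ j) a) :
    best G X θ₀ S = fun j : S => θ₀ j := by
  have h0 : ∑ i, G.cumulant (X i ⬝ᵥ θ₀) (linPred X S (fun j => θ₀ j) i - X i ⬝ᵥ θ₀) = 0 := by
    simp only [linPred_restrict X θ₀ hS, sub_self, GLM.cumulant_zero, Finset.sum_const_zero]
  have hbest : IsBest G X θ₀ S (fun j => θ₀ j) := fun θ' => by
    rw [integral_logLik_sub G X θ₀, h0, zero_sub, neg_nonpos]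
    exact Finset.sum_nonneg fun i _ => G.cumulant_nonneg _ _
  have hspec : IsBest G X θ₀ S (best G X θ₀ S) := Classical.epsilon_spec ⟨_, hbest⟩
  have h := hspec fun j : S => θ₀ j
  rw [integral_logLik_sub G X θ₀, h0, sub_zero] at h
  by_contra hne
  obtain ⟨i, hi⟩ := exists_dotProduct_ne_zero hpos (sub_ne_zero.2 hne)
  have hi' : linPred X S (best G X θ₀ S) i - X i ⬝ᵥ θ₀ ≠ 0 := by
    rw [dotProduct_sub] at hi
    rwa [← linPred_restrict X θ₀ hS]
  have : 0 < ∑ i, G.cumulant (X i ⬝ᵥ θ₀) (linPred X S (best G X θ₀ S) i - X i ⬝ᵥ θ₀) :=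
    Finset.sum_pos' (fun i _ => G.cumulant_nonneg _ _)
      ⟨i, Finset.mem_univ i, G.cumulant_pos _ hi'⟩
  linarith

end Best

/-! ### Consequences of a positive sparse singular value -/

section Sparse

variable (G : GLM) {n p : ℕ} (X : Matrix (Fin n) (Fin p) ℝ) {θ₀ : Fin p → ℝ}

lemma l2norm_sq {m : Type*} [Fintype m] (v : m → ℝ) : l2norm v ^ 2 = ∑ i, v i ^ 2 :=
  Real.sq_sqrt (Finset.sum_nonneg fun _ _ => sq_nonneg _)

lemma sum_extend {S : Finset (Fin p)} (a : S → ℝ) (f : Fin p → ℝ → ℝ) (hf : ∀ j, f j 0 = 0) :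
    ∑ j, f j (extend a j) = ∑ j : S, f j (a j) := by
  rw [← Finset.sum_subset (Finset.subset_univ S) fun j _ hj => by simp [extend, hj, hf]]
  rw [← Finset.sum_coe_sort S fun j => f j (extend a j)]
  refine Finset.sum_congr rfl fun j _ => ?_
  simp [extend]

lemma supp_extend_subset {S : Finset (Fin p)} (a : S → ℝ) : supp (extend a) ⊆ S := by
  intro j hj
  by_contra h
  exact (Finset.mem_filter.1 hj).2 (by simp [extend, h])

lemma supp_nonempty {θ : Fin p → ℝ} (h : θ ≠ 0) : (supp θ).Nonempty := by
  obtain ⟨j, hj⟩ := Function.ne_iff.1 h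
  exact ⟨j, Finset.mem_filter.2 ⟨Finset.mem_univ _, hj⟩⟩

variable {X}

lemma phi2_sq_mul_le (hn : 0 < n) {s : ℝ} (hφ : 0 < phi2 X (weight G X θ₀) s) {θ : Fin p → ℝ}
    (hθ : ((supp θ).card : ℝ) ≤ s) :
    n * phi2 X (weight G X θ₀) s ^ 2 * ∑ j, θ j ^ 2 ≤
      ∑ i, G.b'' (X i ⬝ᵥ θ₀) * (X i ⬝ᵥ θ) ^ 2 := by
  have hn' : (0 : ℝ) < n := by exact_mod_cast hn
  rcases eq_or_ne θ 0 with rfl | hne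
  · simp
  -- positivity of the infimum rules out the junk value of `sInf` at sets without a lower bound
  set A := {r | ∃ θ : Fin p → ℝ, 0 < (supp θ).card ∧ ((supp θ).card : ℝ) ≤ s ∧
    r = quad ((n : ℝ)⁻¹ • (Xᵀ * weight G X θ₀ * X)) θ / l2norm θ ^ 2} with hA
  have h0 : 0 < sInf A := Real.sqrt_pos.1 hφ
  have hbdd : BddBelow A := by
    by_contra h
    rw [Real.sInf_of_not_bddBelow h] at h0
    exact lt_irrefl _ h0
  have hsq : phi2 X (weight G X θ₀) s ^ 2 = sInf A := Real.sq_sqrt h0.le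
  have hle : sInf A ≤ _ := csInf_le hbdd ⟨θ, (supp_nonempty hne).card_pos, hθ, rfl⟩
  have hsum : 0 < ∑ j, θ j ^ 2 := by
    obtain ⟨j, hj⟩ := Function.ne_iff.1 hne
    exact Finset.sum_pos' (fun j _ => sq_nonneg _)
      ⟨j, Finset.mem_univ _, sq_pos_of_ne_zero hj⟩
  have hq : quad ((n : ℝ)⁻¹ • (Xᵀ * weight G X θ₀ * X)) θ =
      (n : ℝ)⁻¹ * ∑ i, G.b'' (X i ⬝ᵥ θ₀) * (X i ⬝ᵥ θ) ^ 2 := by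
    rw [← quad_weightedGram, quad, quad, smul_mulVec, dotProduct_smul, smul_eq_mul]
    rfl
  rw [hq, l2norm_sq, le_div_iff₀ hsum] at hle
  rw [hsq, mul_assoc]
  calc (n : ℝ) * (sInf A * ∑ j, θ j ^ 2) ≤
        n * ((n : ℝ)⁻¹ * ∑ i, G.b'' (X i ⬝ᵥ θ₀) * (X i ⬝ᵥ θ) ^ 2) := by gcongr
    _ = _ := by field_simp

lemma phi2_sq_mul_le_quad (hn : 0 < n) {s : ℝ} (hφ : 0 < phi2 X (weight G X θ₀) s)
    {S : Finset (Fin p)} (hS : supp θ₀ ⊆ S) (hs : (S.card : ℝ) ≤ s) (a : S → ℝ) :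
    n * phi2 X (weight G X θ₀) s ^ 2 * ∑ j, a j ^ 2 ≤ quad (fisher G X S fun j => θ₀ j) a := by
  have h := phi2_sq_mul_le G hn hφ (θ := extend a)
    (le_trans (by exact_mod_cast Finset.card_le_card (supp_extend_subset a)) hs)
  rw [sum_extend a (fun _ x => x ^ 2) (by simp)] at h
  refine h.trans (le_of_eq ?_)
  rw [fisher_eq_weightedGram, quad_weightedGram]
  refine Finset.sum_congr rfl fun i _ => ?_
  have e : X i ⬝ᵥ extend a = colSub X S i ⬝ᵥ a := sum_extend a (fun j x => X i j * x) (by simp)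
  rw [linPred_restrict X θ₀ hS, e]

lemma abs_dotProduct_le_of_quad_le (hn : 0 < n) {s : ℝ} (hφ : 0 < phi2 X (weight G X θ₀) s)
    {S : Finset (Fin p)} (hS : supp θ₀ ⊆ S) (hs : (S.card : ℝ) ≤ s) {M : ℝ}
    (hM : ∀ i j, |X i j| ≤ M) {q : ℝ} (hq : 0 ≤ q) {a : S → ℝ}
    (ha : quad (fisher G X S fun j => θ₀ j) a ≤ q ^ 2) (i : Fin n) :
    |colSub X S i ⬝ᵥ a| ≤ M * √S.card * q / (phi2 X (weight G X θ₀) s * √n) := by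
  have hn' : (0 : ℝ) < n := by exact_mod_cast hn
  set φ := phi2 X (weight G X θ₀) s
  have h1 := (phi2_sq_mul_le_quad G hn hφ hS hs a).trans ha
  have h2 : √(∑ j, a j ^ 2) ≤ q / (φ * √n) := by
    refine Real.sqrt_le_iff.2 ⟨by positivity, ?_⟩
    rw [div_pow, mul_pow, Real.sq_sqrt hn'.le, le_div_iff₀ (by positivity)]
    linarith
  have h3 : √(∑ j, colSub X S i j ^ 2) ≤ M * √S.card := by
    rcases isEmpty_or_nonempty S with hE | ⟨⟨j⟩⟩
    · have : S = ∅ := Finset.isEmpty_coe_sort.1 hE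
      subst this
      simp
    have hM0 : 0 ≤ M := (abs_nonneg _).trans (hM i j)
    refine Real.sqrt_le_iff.2 ⟨by positivity, ?_⟩
    calc _ ≤ ∑ _j : S, M ^ 2 := Finset.sum_le_sum fun j _ => by
            rw [← sq_abs]
            have := hM i j
            simp only [colSub, submatrix_apply, id]
            gcongr
      _ = _ := by
        rw [mul_pow, Real.sq_sqrt (by positivity)]
        simp [mul_comm]
  have h4 : 0 ≤ M * √S.card := (Real.sqrt_nonneg _).trans h3
  calc _ ≤ √(∑ j, colSub X S i j ^ 2) * √(∑ j, a j ^ 2) := abs_dotProduct_le_sqrt_mul_sqrt _ _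
    _ ≤ (M * √S.card) * (q / (φ * √n)) := by gcongr
    _ = _ := by ring

end Sparse

/-! ### The exceptional events -/

section Events

variable (G : GLM) {n p : ℕ} (X : Matrix (Fin n) (Fin p) ℝ) (θ₀ : Fin p → ℝ)

lemma b''_le_sigmaMaxSq (i : Fin n) : G.b'' (X i ⬝ᵥ θ₀) ≤ sigmaMaxSq G X θ₀ :=
  le_ciSup (f := fun i => G.b'' (X i ⬝ᵥ θ₀)) (Set.finite_range _).bddAbove i

/-- A bound in the maximum norm for the score of all models, from the Chernoff bound at the
exponential rate `√(log p / n)`. -/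
lemma exists_event_abs_score_le (hn : 0 < n) (hp : 0 < p) {M B : ℝ} (hM : ∀ i j, |X i j| ≤ M)
    (hB : ∀ j, ∑ i, X i j ^ 2 ≤ B ^ 2 * n) (hsmall : √(Real.log p / n) * M ≤ 1 / 2) :
    ∃ E : Set (Fin n → ℝ), MeasurableSet E ∧ (jointLaw G X θ₀).real Eᶜ ≤ 2 * (p : ℝ)⁻¹ ∧
      ∀ y ∈ E, ∀ j, |∑ i, X i j * G.centred (X i ⬝ᵥ θ₀) (y i)| ≤
        (2 + G.Cdev * sigmaMaxSq G X θ₀ * B ^ 2 / 2) * √(n * Real.log p) := by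
  have hn' : (0 : ℝ) < n := by exact_mod_cast hn
  have hp' : (0 : ℝ) < p := by exact_mod_cast hp
  have hC := G.Cdev_pos
  have hl : 0 ≤ Real.log p := Real.log_natCast_nonneg p
  set σ2 := sigmaMaxSq G X θ₀ with hσ2
  have hσ0 : 0 ≤ σ2 := (G.b''_nonneg _).trans (b''_le_sigmaMaxSq G X θ₀ ⟨0, hn⟩)
  set t := √(Real.log p / n) with ht
  set T := (2 + G.Cdev * σ2 * B ^ 2 / 2) * √(n * Real.log p) with hT
  have ht2 : t ^ 2 * n = Real.log p := by
    rw [ht, Real.sq_sqrt (by positivity)]; field_simp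
  have htT : t * T = (2 + G.Cdev * σ2 * B ^ 2 / 2) * Real.log p := by
    have : t * √(n * Real.log p) = Real.log p := by
      rw [ht, ← Real.sqrt_mul (by positivity)]
      have : Real.log p / n * (n * Real.log p) = Real.log p ^ 2 := by field_simp
      rw [this, Real.sqrt_sq hl]
    rw [hT, mul_left_comm, this]
  let bad : Fin p → ℝ → Set (Fin n → ℝ) := fun j ε =>
    {y | t * T ≤ ∑ i, (t * (ε * X i j)) * G.centred (X i ⬝ᵥ θ₀) (y i)}
  have hbad : ∀ j ε, |ε| = 1 → (jointLaw G X θ₀).real (bad j ε) ≤ ((p : ℝ)⁻¹) ^ 2 := by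
    intro j ε hε
    have hε2 : ε ^ 2 = 1 := by rw [← sq_abs, hε, one_pow]
    refine (measureReal_le_sum_centred_le G (fun i => X i ⬝ᵥ θ₀) (fun i => t * (ε * X i j))
      (fun i => ?_) _).trans ?_
    · rw [abs_mul, abs_mul, hε, one_mul, abs_of_nonneg (Real.sqrt_nonneg _)]
      exact (mul_le_mul_of_nonneg_left (hM i j) (Real.sqrt_nonneg _)).trans hsmall
    · have e1 : ∑ i, G.b'' (X i ⬝ᵥ θ₀) * (t * (ε * X i j)) ^ 2 ≤ σ2 * B ^ 2 * Real.log p := by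
        calc _ ≤ ∑ i, σ2 * t ^ 2 * X i j ^ 2 := Finset.sum_le_sum fun i _ => by
                have h1 := b''_le_sigmaMaxSq G X θ₀ i
                have h2 : (t * (ε * X i j)) ^ 2 = t ^ 2 * X i j ^ 2 := by
                  rw [mul_pow, mul_pow, hε2, one_mul]
                rw [h2, mul_assoc]
                gcongr
          _ = σ2 * t ^ 2 * ∑ i, X i j ^ 2 := by rw [Finset.mul_sum]
          _ ≤ σ2 * t ^ 2 * (B ^ 2 * n) := by gcongr; exact hB j
          _ = _ := by rw [← ht2]; ring
      have e2 : ((p : ℝ)⁻¹) ^ 2 = Real.exp (-(2 * Real.log p)) := by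
        rw [Real.exp_neg, two_mul, Real.exp_add, Real.exp_log hp', inv_pow, sq]
      rw [e2]
      apply Real.exp_le_exp.2
      rw [htT]
      have := mul_le_mul_of_nonneg_left e1 (show 0 ≤ G.Cdev / 2 by positivity)
      linarith
  refine ⟨{y | ∀ j, |∑ i, X i j * G.centred (X i ⬝ᵥ θ₀) (y i)| ≤ T}, ?_, ?_, fun y hy => hy⟩
  · have e : {y : Fin n → ℝ | ∀ j, |∑ i, X i j * G.centred (X i ⬝ᵥ θ₀) (y i)| ≤ T} =
        ⋂ j, {y | |∑ i, X i j * G.centred (X i ⬝ᵥ θ₀) (y i)| ≤ T} := by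
      ext y
      simp
    rw [e]
    refine MeasurableSet.iInter fun j => measurableSet_le ?_ measurable_const
    exact (measurable_sum_centred G (fun i => X i ⬝ᵥ θ₀) fun i => X i j).abs
  · have hsub : {y : Fin n → ℝ | ∀ j, |∑ i, X i j * G.centred (X i ⬝ᵥ θ₀) (y i)| ≤ T}ᶜ ⊆
        ⋃ j, (bad j 1 ∪ bad j (-1)) := by
      intro y hy
      simp only [Set.mem_compl_iff, Set.mem_ofPred_eq, not_forall, not_le] at hy
      obtain ⟨j, hj⟩ := hy
      refine Set.mem_iUnion.2 ⟨j, ?_⟩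
      have hlin : ∀ ε : ℝ, ∑ i, (t * (ε * X i j)) * G.centred (X i ⬝ᵥ θ₀) (y i) =
          t * (ε * ∑ i, X i j * G.centred (X i ⬝ᵥ θ₀) (y i)) := by
        intro ε
        simp only [Finset.mul_sum]
        exact Finset.sum_congr rfl fun i _ => by ring
      have ht0 : 0 ≤ t := Real.sqrt_nonneg _
      rcases lt_abs.1 hj with h | h
      · left
        change t * T ≤ ∑ i, (t * (1 * X i j)) * _
        rw [hlin, one_mul]
        exact mul_le_mul_of_nonneg_left h.le ht0
      · right
        change t * T ≤ ∑ i, (t * (-1 * X i j)) * _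
        rw [hlin, neg_one_mul]
        exact mul_le_mul_of_nonneg_left h.le ht0
    refine (measureReal_mono hsub (measure_ne_top _ _)).trans
      ((measureReal_iUnion_fintype_le _).trans ?_)
    calc _ ≤ ∑ _j : Fin p, 2 * ((p : ℝ)⁻¹) ^ 2 := Finset.sum_le_sum fun j _ => by
            refine (measureReal_union_le _ _).trans ?_
            have h1 := hbad j 1 (by simp)
            have h2 := hbad j (-1) (by simp)
            linarith
      _ = 2 * (p : ℝ)⁻¹ := by
        simp; field_simp

/-- The number of models of size `s` is at most `p ^ s`, so deviation probabilities `p ^ (-4 s)`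
sum up to less than `1 / p`. -/
lemma sum_pow_card_le {p : ℕ} (hp : 2 ≤ p) (𝒮 : Finset (Finset (Fin p)))
    (h𝒮 : ∀ S ∈ 𝒮, S.Nonempty) : ∑ S ∈ 𝒮, (((p : ℝ)⁻¹) ^ 4) ^ S.card ≤ (p : ℝ)⁻¹ := by
  have hp' : (2 : ℝ) ≤ p := by exact_mod_cast hp
  set x : ℝ := ((p : ℝ)⁻¹) ^ 4 with hx
  have hx0 : 0 ≤ x := by positivity
  have h1 : ∑ S : Finset (Fin p), x ^ S.card = (x + 1) ^ p := by
    simpa using Fin.sum_pow_mul_eq_add_pow (n := p) x 1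
  have h2 : 1 + ∑ S ∈ 𝒮, x ^ S.card ≤ (x + 1) ^ p := by
    rw [← h1]
    have hnot : ∅ ∉ 𝒮 := fun h => by simpa using h𝒮 ∅ h
    have : 1 + ∑ S ∈ 𝒮, x ^ S.card = ∑ S ∈ insert ∅ 𝒮, x ^ S.card := by
      rw [Finset.sum_insert hnot]; simp
    rw [this]
    exact Finset.sum_le_sum_of_subset_of_nonneg (Finset.subset_univ _) fun S _ _ => by positivity
  have h3 : (x + 1) ^ p ≤ Real.exp (p * x) := by
    rw [Real.exp_nat_mul]
    gcongr
    exact Real.add_one_le_exp x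
  have hy : (p : ℝ) * x = ((p : ℝ)⁻¹) ^ 3 := by rw [hx]; field_simp
  have hq : (p : ℝ)⁻¹ ≤ 1 / 2 := by rw [inv_eq_one_div]; gcongr
  have hq0 : 0 ≤ (p : ℝ)⁻¹ := by positivity
  have h4 := Real.abs_exp_sub_one_le (x := ((p : ℝ)⁻¹) ^ 3) (by
    rw [abs_of_nonneg (by positivity)]
    exact pow_le_one₀ hq0 (by linarith))
  rw [abs_of_nonneg (pow_nonneg hq0 3)] at h4
  have h5 := (abs_le.1 h4).2
  rw [hy] at h3
  have h6 : ((p : ℝ)⁻¹) ^ 3 ≤ (p : ℝ)⁻¹ * (1 / 4) := by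
    rw [pow_succ' _ 2]
    gcongr
    nlinarith
  linarith

/-- Simultaneously for all sparse models that contain the true one, the score is of order
`√(|S| log p)` in the norm dual to the one of the Fisher information. -/
lemma exists_event_forall_score_le (hn : 0 < n) (hp : 2 ≤ p) (hθ₀ : θ₀ ≠ 0) {s : ℝ}
    (hφ : 0 < phi2 X (weight G X θ₀) s) {M : ℝ} (hM : ∀ i j, |X i j| ≤ M)
    (hsmall : 2 * (M * s * √(Real.log p)) ≤ 1 / 2 * (phi2 X (weight G X θ₀) s * √n)) :
    ∃ E : Set (Fin n → ℝ), MeasurableSet E ∧ (jointLaw G X θ₀).real Eᶜ ≤ (p : ℝ)⁻¹ ∧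
      ∀ y ∈ E, ∀ S : Finset (Fin p), supp θ₀ ⊆ S → (S.card : ℝ) ≤ s → ∀ a : S → ℝ,
        ∑ i, (colSub X S i ⬝ᵥ a) * G.centred (X i ⬝ᵥ θ₀) (y i) ≤
          2 * ((2 * G.Cdev + 8) * √(S.card * Real.log p)) *
            √(quad (fisher G X S fun j => θ₀ j) a) := by
  classical
  have hn' : (0 : ℝ) < n := by exact_mod_cast hn
  have hp' : (2 : ℝ) ≤ p := by exact_mod_cast hp
  have hl : 0 ≤ Real.log p := Real.log_natCast_nonneg p
  set φ := phi2 X (weight G X θ₀) s with hφdef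
  let 𝒮 : Finset (Finset (Fin p)) :=
    Finset.univ.filter fun S => supp θ₀ ⊆ S ∧ (S.card : ℝ) ≤ s
  have hne : ∀ S ∈ 𝒮, S.Nonempty := fun S hS =>
    (supp_nonempty hθ₀).mono (Finset.mem_filter.1 hS).2.1
  have key : ∀ S ∈ 𝒮, ∃ E : Set (Fin n → ℝ), MeasurableSet E ∧
      (jointLaw G X θ₀).real Eᶜ ≤ (((p : ℝ)⁻¹) ^ 4) ^ S.card ∧
      ∀ y ∈ E, ∀ a : S → ℝ, ∑ i, (colSub X S i ⬝ᵥ a) * G.centred (X i ⬝ᵥ θ₀) (y i) ≤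
          2 * ((2 * G.Cdev + 8) * √(S.card * Real.log p)) *
            √(quad (fisher G X S fun j => θ₀ j) a) := by
    intro S hS
    obtain ⟨-, hS0, hSs⟩ := Finset.mem_filter.1 hS
    obtain ⟨j₀, hj₀⟩ := hne S hS
    have : Nonempty S := ⟨⟨j₀, hj₀⟩⟩
    have hM0 : 0 ≤ M := (abs_nonneg _).trans (hM ⟨0, hn⟩ j₀)
    have hF : fisher G X S (fun j => θ₀ j) =
        weightedGram (colSub X S) fun i => G.b'' (X i ⬝ᵥ θ₀) := by
      rw [fisher_eq_weightedGram]
      simp only [linPred_restrict X θ₀ hS0]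
    have hpos : ∀ a, a ≠ 0 → 0 < quad (fisher G X S fun j => θ₀ j) a := fun a ha => by
      obtain ⟨j, hj⟩ := Function.ne_iff.1 ha
      exact lt_of_lt_of_le (mul_pos (by positivity) (Finset.sum_pos' (fun j _ => sq_nonneg _)
        ⟨j, Finset.mem_univ _, sq_pos_of_ne_zero hj⟩)) (phi2_sq_mul_le_quad G hn hφ hS0 hSs a)
    have ht : ∀ a, quad (fisher G X S fun j => θ₀ j) a ≤ 4 →
        ∀ i, |√(S.card * Real.log p) * (colSub X S i ⬝ᵥ a)| ≤ 1 / 2 := by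
      intro a ha i
      have h1 := abs_dotProduct_le_of_quad_le G hn hφ hS0 hSs hM (q := 2) (by norm_num)
        (ha.trans (by norm_num)) i
      rw [abs_mul, abs_of_nonneg (Real.sqrt_nonneg _)]
      have hc : √(S.card : ℝ) * √(S.card : ℝ) = S.card := Real.mul_self_sqrt (by positivity)
      calc _ ≤ √(S.card * Real.log p) * (M * √S.card * 2 / (φ * √n)) := by gcongr
        _ = 2 * (M * S.card * √(Real.log p)) / (φ * √n) := by
            rw [Real.sqrt_mul (by positivity)]
            linear_combination (2 * M * √(Real.log p) / (φ * √n)) * hc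
        _ ≤ 2 * (M * s * √(Real.log p)) / (φ * √n) := by gcongr
        _ ≤ 1 / 2 := by rw [div_le_iff₀ (by positivity)]; exact hsmall
    rw [hF] at hpos ht
    -- with exponent `t = √(|S| log p)` each direction fails with probability at most `p ^ (-8 |S|)`,
    -- of which the `(4 |S| + 1) ^ |S| ≤ p ^ (4 |S|)` directions consume one half
    obtain ⟨E, hE, hPE, hyE⟩ := exists_event_score_le G (colSub X S) (fun i => X i ⬝ᵥ θ₀) hpos ht
      (Real.sqrt_nonneg _) ((2 * G.Cdev + 8) * √(S.card * Real.log p))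
    refine ⟨E, hE, hPE.trans ?_, ?_⟩
    · rw [Fintype.card_coe]
      have hcard : (S.card : ℝ) ≤ p := by
        have := Finset.card_le_univ S
        rw [Fintype.card_fin] at this
        exact_mod_cast this
      have e1 : -(√(S.card * Real.log p) * ((2 * G.Cdev + 8) * √(S.card * Real.log p))) +
          2 * G.Cdev * √(S.card * Real.log p) ^ 2 = S.card * (-(8 * Real.log p)) := by
        have h := Real.sq_sqrt (show 0 ≤ S.card * Real.log p by positivity)
        linear_combination (-8) * h
      have e2 : Real.exp (-(8 * Real.log p)) = ((p : ℝ)⁻¹) ^ 8 := by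
        rw [Real.exp_neg, mul_comm, Real.exp_mul, Real.exp_log (by linarith)]
        rw [inv_pow]
        norm_cast
      rw [e1, Real.exp_nat_mul, e2, ← mul_pow]
      gcongr
      have h5 : (4 * S.card + 1 : ℝ) ≤ (p : ℝ) ^ 4 := by
        have h8 : (8 : ℝ) ≤ (p : ℝ) ^ 3 := by
          calc (8 : ℝ) = 2 ^ 3 := by norm_num
            _ ≤ _ := by gcongr
        nlinarith
      calc _ ≤ (p : ℝ) ^ 4 * ((p : ℝ)⁻¹) ^ 8 := by gcongr
        _ = _ := by field_simp
    · intro y hy a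
      rw [hF]
      exact hyE y hy a
  choose! E hE hPE hyE using key
  refine ⟨⋂ S ∈ 𝒮, E S, Finset.measurableSet_biInter _ fun S hS => hE S hS, ?_, ?_⟩
  · simp only [Set.compl_iInter]
    refine (measureReal_biUnion_finset_le _ _).trans ?_
    exact (Finset.sum_le_sum hPE).trans (sum_pow_card_le hp 𝒮 hne)
  · intro y hy S hS0 hSs
    have hS : S ∈ 𝒮 := Finset.mem_filter.2 ⟨Finset.mem_univ _, hS0, hSs⟩
    simp only [Set.mem_iInter] at hy
    exact hyE S hS y (hy S hS)

end Events

/-! ### The error bound for a fixed sample size -/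

/-- The radius, in units of `√(|S| log p)`, of the ellipsoid that contains the maximum likelihood
estimate of model `S`. -/
def GLM.radConst (G : GLM) : ℝ := 8 * G.Cdev * (2 * G.Cdev + 8)

lemma GLM.radConst_pos (G : GLM) : 0 < G.radConst := by
  have := G.Cdev_pos
  rw [GLM.radConst]; positivity

/-- For a response vector with small scores, the maximum likelihood estimate of a sparse model that
contains the true one is unique and close to the truth in the maximum norm. -/
lemma existsUnique_mle_and_abs_sub_best_le (G : GLM) {n p : ℕ} {X : Matrix (Fin n) (Fin p) ℝ}
    {θ₀ : Fin p → ℝ} (hn : 0 < n) (hp : 2 ≤ p) (hθ₀ : θ₀ ≠ 0) {s : ℝ}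
    (hφ : 0 < phi2 X (weight G X θ₀) s) {M T : ℝ} (hM : ∀ i j, |X i j| ≤ M)
    (hsmall : (G.radConst + 2) * (M * s * √(Real.log p)) ≤
      1 / 2 * (phi2 X (weight G X θ₀) s * √n))
    {S : Finset (Fin p)} (hS0 : supp θ₀ ⊆ S) (hSs : (S.card : ℝ) ≤ s) {y : Fin n → ℝ}
    (hT : ∀ j, |∑ i, X i j * G.centred (X i ⬝ᵥ θ₀) (y i)| ≤ T)
    (hscore : ∀ a : S → ℝ, ∑ i, (colSub X S i ⬝ᵥ a) * G.centred (X i ⬝ᵥ θ₀) (y i) ≤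
      2 * ((2 * G.Cdev + 8) * √(S.card * Real.log p)) *
        √(quad (fisher G X S fun j => θ₀ j) a)) :
    (∃! θ : S → ℝ, IsMLE G X S y θ) ∧ ∀ θ : S → ℝ, IsMLE G X S y θ → ∀ j : S,
      |θ j - best G X θ₀ S j| ≤ rowSumNorm (fisherBest G X θ₀ S)⁻¹ *
        (T + M * (G.remConst * (1 + √(sigmaMaxSq G X θ₀))) *
          (G.radConst ^ 2 * s * Real.log p)) := by
  have hn' : (0 : ℝ) < n := by exact_mod_cast hn
  have hp' : (2 : ℝ) ≤ p := by exact_mod_cast hp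
  have hl : 0 < Real.log p := Real.log_pos (by linarith)
  have hC := G.Cdev_pos
  have hrad : 0 < G.radConst := G.radConst_pos
  have hL := G.remConst_pos
  obtain ⟨j₀, hj₀⟩ := supp_nonempty hθ₀
  have hM0 : 0 ≤ M := (abs_nonneg _).trans (hM ⟨0, hn⟩ j₀)
  have hs : 0 ≤ s := le_trans (by positivity) hSs
  set φ := phi2 X (weight G X θ₀) s with hφdef
  have hF := phi2_sq_mul_le_quad G hn hφ hS0 hSs
  have hc : 0 < n * φ ^ 2 := by positivity
  have hpos : ∀ a, a ≠ 0 → 0 < quad (fisher G X S fun j => θ₀ j) a := fun a ha => by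
    obtain ⟨j, hj⟩ := Function.ne_iff.1 ha
    exact lt_of_lt_of_le (mul_pos hc (Finset.sum_pos' (fun j _ => sq_nonneg _)
      ⟨j, Finset.mem_univ _, sq_pos_of_ne_zero hj⟩)) (hF a)
  have hbest := best_eq_restrict G X θ₀ hS0 hpos
  have hcard : (0 : ℝ) < S.card := by
    exact_mod_cast Finset.card_pos.2 ⟨j₀, hS0 hj₀⟩
  obtain ⟨r, hr⟩ : ∃ r, r = G.radConst * √(S.card * Real.log p) := ⟨_, rfl⟩
  have hsq : 0 < √(S.card * Real.log p) := by positivity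
  have hr0 : 0 ≤ r := by rw [hr]; positivity
  have hloc : ∀ a, quad (fisher G X S fun j => θ₀ j) a ≤ r ^ 2 →
      ∀ i, |colSub X S i ⬝ᵥ a| ≤ 1 / 2 := by
    intro a ha i
    refine (abs_dotProduct_le_of_quad_le G hn hφ hS0 hSs hM hr0 ha i).trans ?_
    rw [div_le_iff₀ (by positivity)]
    refine le_trans ?_ hsmall
    have hcc : √(S.card : ℝ) * √(S.card : ℝ) = S.card := Real.mul_self_sqrt (by positivity)
    calc M * √S.card * r = G.radConst * (M * S.card * √(Real.log p)) := by
          rw [hr, Real.sqrt_mul (by positivity)]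
          linear_combination (G.radConst * M * √(Real.log p)) * hcc
      _ ≤ (G.radConst + 2) * (M * s * √(Real.log p)) := by
          gcongr
          linarith
  have hscore' : ∀ a : S → ℝ,
      ∑ i, (colSub X S i ⬝ᵥ a) * G.centred (linPred X S (fun j => θ₀ j) i) (y i) ≤
        2 * ((2 * G.Cdev + 8) * √(S.card * Real.log p)) *
          √(quad (fisher G X S fun j => θ₀ j) a) := by
    simpa only [linPred_restrict X θ₀ hS0] using hscore
  have hru : 2 * G.Cdev * (2 * ((2 * G.Cdev + 8) * √(S.card * Real.log p))) < r := by
    rw [hr, GLM.radConst]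
    have : 0 < G.Cdev * (2 * G.Cdev + 8) * √(S.card * Real.log p) := by positivity
    linarith
  have hu : 0 ≤ 2 * ((2 * G.Cdev + 8) * √(S.card * Real.log p)) := by positivity
  obtain ⟨hex, hin⟩ := existsUnique_mle_of_score_le hc hF hu hscore' hru hloc
  refine ⟨hex, fun θ hθ j => ?_⟩
  have hPD : (fisher G X S fun j => θ₀ j).PosDef := by
    rw [fisher_eq_weightedGram] at hpos ⊢
    exact posDef_weightedGram hpos
  have hdet : IsUnit (fisher G X S fun j => θ₀ j).det := isUnit_iff_ne_zero.2 hPD.det_pos.ne'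
  have h := hθ.abs_sub_le hdet (hin θ hθ) (hloc _ (hin θ hθ)) hM
    (σ := √(sigmaMaxSq G X θ₀))
    (fun i => by
      rw [linPred_restrict X θ₀ hS0]
      exact Real.sqrt_le_sqrt (b''_le_sigmaMaxSq G X θ₀ i))
    (T := T)
    (fun j => by
      simp only [linPred_restrict X θ₀ hS0]
      exact hT j) j
  rw [fisherBest, hbest]
  refine h.trans ?_
  have hrow : 0 ≤ rowSumNorm (fisher G X S fun j => θ₀ j)⁻¹ :=
    Real.iSup_nonneg fun _ => Finset.sum_nonneg fun _ _ => abs_nonneg _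
  have hr2 : r ^ 2 ≤ G.radConst ^ 2 * s * Real.log p := by
    rw [hr, mul_pow, Real.sq_sqrt (by positivity), mul_assoc]
    gcongr
  gcongr

/-- With probability at least `1 - 3 / p`, the score is small both in the maximum norm and in the
norms dual to the Fisher informations, hence all sparse models that contain the true one have a
unique maximum likelihood estimate with a small error. -/
lemma exists_event_mle (G : GLM) {n p : ℕ} (X : Matrix (Fin n) (Fin p) ℝ) (θ₀ : Fin p → ℝ)
    (hn : 0 < n) (hp : 2 ≤ p) (hθ₀ : θ₀ ≠ 0) {s : ℝ}
    (hφ : 0 < phi2 X (weight G X θ₀) s) {M B : ℝ} (hM : ∀ i j, |X i j| ≤ M)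
    (hB : ∀ j, ∑ i, X i j ^ 2 ≤ B ^ 2 * n) (hsmall : √(Real.log p / n) * M ≤ 1 / 2)
    (hsmall' : (G.radConst + 2) * (M * s * √(Real.log p)) ≤
      1 / 2 * (phi2 X (weight G X θ₀) s * √n)) :
    ∃ E : Set (Fin n → ℝ), MeasurableSet E ∧
      ENNReal.ofReal (1 - 3 * (p : ℝ)⁻¹) ≤ jointLaw G X θ₀ E ∧
      ∀ y ∈ E, ∀ S : Finset (Fin p), supp θ₀ ⊆ S → (S.card : ℝ) ≤ s →
        (∃! θ : S → ℝ, IsMLE G X S y θ) ∧ ∀ θ : S → ℝ, IsMLE G X S y θ → ∀ j : S,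
          |θ j - best G X θ₀ S j| ≤ rowSumNorm (fisherBest G X θ₀ S)⁻¹ *
            ((2 + G.Cdev * sigmaMaxSq G X θ₀ * B ^ 2 / 2) * √(n * Real.log p) +
              M * (G.remConst * (1 + √(sigmaMaxSq G X θ₀))) *
                (G.radConst ^ 2 * s * Real.log p)) := by
  have hn' : (0 : ℝ) < n := by exact_mod_cast hn
  have hp' : (2 : ℝ) ≤ p := by exact_mod_cast hp
  have hl : 0 < Real.log p := Real.log_pos (by linarith)
  have hC := G.Cdev_pos
  have hrad : 0 < G.radConst := G.radConst_pos
  have hL := G.remConst_pos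
  obtain ⟨j₀, hj₀⟩ := supp_nonempty hθ₀
  have hM0 : 0 ≤ M := (abs_nonneg _).trans (hM ⟨0, hn⟩ j₀)
  set φ := phi2 X (weight G X θ₀) s with hφdef
  -- for negative `s` there are no models of size at most `s`
  by_cases hs : s < 0
  · refine ⟨Set.univ, MeasurableSet.univ, ?_, fun y _ S _ hS => ?_⟩
    · rw [measure_univ]
      refine ENNReal.ofReal_le_one.2 ?_
      have : 0 ≤ (p : ℝ)⁻¹ := by positivity
      linarith
    · have : (0 : ℝ) ≤ S.card := by positivity
      linarith
  push Not at hs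
  have hsp : 0 ≤ M * s * √(Real.log p) := by positivity
  obtain ⟨E₁, hE₁, hP₁, hy₁⟩ := exists_event_abs_score_le G X θ₀ hn (by omega) hM hB hsmall
  obtain ⟨E₂, hE₂, hP₂, hy₂⟩ := exists_event_forall_score_le G X θ₀ hn hp hθ₀ hφ hM
    (le_trans (by nlinarith) hsmall')
  refine ⟨E₁ ∩ E₂, hE₁.inter hE₂, ?_, ?_⟩
  · have h1 : (jointLaw G X θ₀).real (E₁ ∩ E₂)ᶜ ≤ 3 * (p : ℝ)⁻¹ := by
      rw [Set.compl_inter]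
      refine (measureReal_union_le _ _).trans ?_
      linarith
    rw [probReal_compl_eq_one_sub (hE₁.inter hE₂)] at h1
    rw [← ofReal_measureReal (measure_ne_top _ _)]
    exact ENNReal.ofReal_le_ofReal (by linarith)
  · rintro y ⟨hyE₁, hyE₂⟩ S hS0 hSs
    exact existsUnique_mle_and_abs_sub_best_le G hn hp hθ₀ hφ hM hsmall' hS0 hSs (hy₁ y hyE₁)
      (hy₂ y hyE₂ S hS0 hSs)

/-! ### The asymptotic statement -/

section Norms

variable (G : GLM) {n p : ℕ} (X : Matrix (Fin n) (Fin p) ℝ) (θ₀ : Fin p → ℝ)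

lemma abs_le_maxNorm (i : Fin n) (j : Fin p) : |X i j| ≤ maxNorm X :=
  (le_ciSup (f := fun j => |X i j|) (Set.finite_range _).bddAbove j).trans
    (le_ciSup (f := fun i => ⨆ j, |X i j|) (Set.finite_range _).bddAbove i)

lemma maxNorm_nonneg : 0 ≤ maxNorm X :=
  Real.iSup_nonneg fun _ => Real.iSup_nonneg fun _ => abs_nonneg _

lemma sigmaMaxSq_nonneg : 0 ≤ sigmaMaxSq G X θ₀ := Real.iSup_nonneg fun _ => G.b''_nonneg _

lemma one_add_sigmaMaxSq_le_nu : 1 + sigmaMaxSq G X θ₀ ≤ nu G X θ₀ := by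
  have hl : 0 < Real.log 2 := Real.log_pos (by norm_num)
  have hl1 : Real.log 2 ≤ 1 := by have := Real.log_two_lt_d9; linarith
  have h0 := sigmaMaxSq_nonneg G X θ₀
  have h1 : sigmaMaxSq G X θ₀ ≤ sigmaMaxSq G X θ₀ / Real.log 2 := by
    rw [le_div_iff₀ hl]; nlinarith
  have h2 : 0 ≤ 2 / (Real.exp 1 * Real.log 2) := by positivity
  rw [nu]
  nlinarith

variable {X θ₀}

/-- A sparse singular value is at most the norm of a column of the weighted design. -/
lemma phi2_le (hn : 0 < n) (hθ₀ : θ₀ ≠ 0) {s : ℝ} (hs : 1 ≤ s)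
    (hφ : 0 < phi2 X (weight G X θ₀) s) {B : ℝ} (hB0 : 0 ≤ B)
    (hB : ∀ j, ∑ i, X i j ^ 2 ≤ B ^ 2 * n) :
    phi2 X (weight G X θ₀) s ≤ √(sigmaMaxSq G X θ₀) * B := by
  classical
  have hn' : (0 : ℝ) < n := by exact_mod_cast hn
  obtain ⟨j, -⟩ := supp_nonempty hθ₀
  have hsupp : supp (Pi.single j (1 : ℝ)) = {j} := by
    ext l
    simp [supp, Pi.single_apply]
  have h := phi2_sq_mul_le G hn hφ (θ := Pi.single j 1) (by rw [hsupp]; simpa using hs)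
  have h1 : ∑ l, (Pi.single j (1 : ℝ) : Fin p → ℝ) l ^ 2 = 1 := by
    simp [Pi.single_apply]
  rw [h1, mul_one] at h
  have h2 : ∑ i, G.b'' (X i ⬝ᵥ θ₀) * (X i ⬝ᵥ Pi.single j 1) ^ 2 ≤
      sigmaMaxSq G X θ₀ * (B ^ 2 * n) := by
    calc _ ≤ ∑ i, sigmaMaxSq G X θ₀ * X i j ^ 2 := Finset.sum_le_sum fun i _ => by
            rw [dotProduct_single, mul_one]
            exact mul_le_mul_of_nonneg_right (b''_le_sigmaMaxSq G X θ₀ i) (sq_nonneg _)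
      _ = sigmaMaxSq G X θ₀ * ∑ i, X i j ^ 2 := by rw [Finset.mul_sum]
      _ ≤ _ := mul_le_mul_of_nonneg_left (hB j) (sigmaMaxSq_nonneg G X θ₀)
  refine le_of_sq_le_sq ?_ (by positivity)
  rw [mul_pow, Real.sq_sqrt (sigmaMaxSq_nonneg G X θ₀)]
  nlinarith

end Norms

/-- The common bound for the linear term and for the quadratic remainder of the likelihood
equations. -/
lemma score_add_remainder_le {n C σ2 B M L k c s₀ l φ ν : ℝ} (hn : 0 < n) (hC : 0 ≤ C)
    (hσ : 0 ≤ σ2) (hB : 0 ≤ B) (hL : 0 ≤ L) (hk : 0 ≤ k) (hl : 0 ≤ l)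
    (hM : M * s₀ * √l ≤ φ * √n) (hφ : φ ≤ √σ2 * B) (hν : 1 + σ2 ≤ ν) :
    (2 + C * σ2 * B ^ 2 / 2) * √(n * l) + M * (L * (1 + √σ2)) * (c ^ 2 * (k * s₀) * l) ≤
      (2 + C * B ^ 2 / 2 + 2 * L * c ^ 2 * k * B) * ν * √(n * l) := by
  have hll : √l * √l = l := Real.mul_self_sqrt hl
  have hss : √σ2 * √σ2 = σ2 := Real.mul_self_sqrt hσ
  have hs0 := Real.sqrt_nonneg σ2
  have hnl : √(n * l) = √n * √l := Real.sqrt_mul hn.le l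
  have hw : 0 ≤ √(n * l) := Real.sqrt_nonneg _
  have h1 : M * s₀ * l ≤ √σ2 * B * √(n * l) := by
    calc M * s₀ * l = M * s₀ * √l * √l := by rw [mul_assoc (M * s₀), hll]
      _ ≤ φ * √n * √l := by gcongr
      _ = φ * √(n * l) := by rw [hnl]; ring
      _ ≤ _ := by gcongr
  have h2 : (1 + √σ2) * √σ2 ≤ 2 * ν := by nlinarith [sq_nonneg (√σ2 - 1)]
  calc _ = (2 + C * B ^ 2 / 2 * σ2) * √(n * l) +
        L * c ^ 2 * k * (1 + √σ2) * (M * s₀ * l) := by ring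
    _ ≤ (2 * ν + C * B ^ 2 / 2 * ν) * √(n * l) +
        L * c ^ 2 * k * (1 + √σ2) * (√σ2 * B * √(n * l)) := by
        gcongr
        · linarith
        · linarith
    _ = (2 * ν + C * B ^ 2 / 2 * ν) * √(n * l) +
        L * c ^ 2 * k * B * √(n * l) * ((1 + √σ2) * √σ2) := by ring
    _ ≤ (2 * ν + C * B ^ 2 / 2 * ν) * √(n * l) +
        L * c ^ 2 * k * B * √(n * l) * (2 * ν) := by gcongr
    _ = _ := by ring

lemma mul_sqrt_le_of_sq_le {M s l φ n ε : ℝ} (hφ : 0 < φ) (hn : 0 ≤ n) (hε : 0 ≤ ε)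
    (hl : 0 ≤ l) (h : M ^ 2 * s ^ 2 * l / φ ^ 2 ≤ ε ^ 2 * n) :
    M * s * √l ≤ ε * (φ * √n) := by
  rw [div_le_iff₀ (by positivity)] at h
  refine le_of_sq_le_sq ?_ (by positivity)
  rw [mul_pow, mul_pow, mul_pow, mul_pow, Real.sq_sqrt hl, Real.sq_sqrt hn]
  linarith

end SparseGLM

end

open SparseGLM
theorem theorem4p3
    (G : GLM) (R : Regime)
    (A₁ A₂ A₃ A₄ A₅ A₆ A₇ A₈ Kcubic α Kdim Ktheta : ℝ) (D κ : ℕ → ℝ)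
    (hKdim : 1 < Kdim) (hKtheta : 0 < Ktheta)
    (hstanding : Standing R)
    (hprior : PriorSize R A₁ A₂ A₃ A₄)
    (hA1 : CondA1 G R D)
    (hA2 : CondA2 G R D α A₄ A₅ A₆ A₇)
    (hA3 : CondA3 G R Kdim)
    (hA4 : CondA4 G R Kdim Ktheta A₈ Kcubic)
    (hA5 : CondA5 G R Kdim Ktheta α A₄ A₇)
    (hA6 : CondA6 G R Kdim Ktheta κ) :
    ∃ K : ℝ, 0 < K ∧ ∀ᶠ n : ℕ in atTop,
      WithProbAtLeast (R.law G n) (1 - 3 * (R.p n : ℝ)⁻¹)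
        {y | ∀ S ∈ modelsFP G (R.X n) (R.θ₀ n) Kdim Ktheta,
          (∃! θhat : S → ℝ, IsMLE G (R.X n) S y θhat) ∧
          ∀ θhat : S → ℝ, IsMLE G (R.X n) S y θhat →
            ∀ j : S, |θhat j - best G (R.X n) (R.θ₀ n) S j| ≤
              K * nu G (R.X n) (R.θ₀ n) * κ n * √(R.logp n / n)} := by
  obtain ⟨⟨C, hC0, hpC⟩, hst⟩ := hstanding
  obtain ⟨hφ, hA3⟩ := hA3
  obtain ⟨hmax, hcol, hκ, -⟩ := hA6
  obtain ⟨B, hB0, hcol⟩ := hcol.exists_pos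
  have hC := G.Cdev_pos
  have hL := G.remConst_pos
  have hrad := G.radConst_pos
  have hk : 0 < Kdim + 1 := by linarith
  obtain ⟨ε, hε⟩ : ∃ ε, ε = 1 / (2 * (Kdim + 1) * (G.radConst + 2)) := ⟨_, rfl⟩
  have hε0 : 0 < ε := by rw [hε]; positivity
  have hεk : (G.radConst + 2) * (Kdim + 1) * ε = 1 / 2 := by rw [hε]; field_simp
  have hε1 : ε ≤ 1 := by
    rw [hε, div_le_one (by positivity)]
    nlinarith
  have hp2 : ∀ᶠ n : ℕ in atTop, 2 ≤ R.p n := by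
    have h1 : Tendsto (fun n : ℕ => (n : ℝ) ^ C) atTop atTop :=
      (tendsto_rpow_atTop hC0).comp tendsto_natCast_atTop_atTop
    filter_upwards [hpC, h1.eventually_ge_atTop 2] with n h2 h3
    exact_mod_cast h3.trans h2
  refine ⟨2 + G.Cdev * B ^ 2 / 2 + 2 * G.remConst * G.radConst ^ 2 * (Kdim + 1) * B,
    by positivity, ?_⟩
  filter_upwards [hp2, eventually_gt_atTop 0, hst, hφ, hA3.bound (sq_pos_of_pos hε0),
    hmax.bound (show (0 : ℝ) < 1 / 4 by norm_num), hcol.bound, hκ]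
    with n hp hn hst hφ hA3 hmax hcol hκ
  have hn' : (0 : ℝ) < n := by exact_mod_cast hn
  have hp' : (2 : ℝ) ≤ R.p n := by exact_mod_cast hp
  have hl : 0 < Real.log (R.p n) := Real.log_pos (by linarith)
  set X := R.X n with hX
  set θ₀ := R.θ₀ n with hθ₀
  have hM0 := maxNorm_nonneg X
  have hs1 : 1 ≤ R.s₀ n := by
    have : 1 ≤ (supp θ₀).card := (supp_nonempty hst.1).card_pos
    change (1 : ℝ) ≤ ((supp θ₀).card : ℕ)
    exact_mod_cast this
  set s := (Kdim + 1) * R.s₀ n with hs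
  have hs1' : 1 ≤ s := by nlinarith
  change 0 < phi2 X (weight G X θ₀) s at hφ
  set φ := phi2 X (weight G X θ₀) s with hφdef
  have hA3' : maxNorm X ^ 2 * R.s₀ n ^ 2 * Real.log (R.p n) / φ ^ 2 ≤ ε ^ 2 * n := by
    have h := (le_abs_self _).trans hA3
    rwa [Real.norm_of_nonneg hn'.le] at h
  have hMs := mul_sqrt_le_of_sq_le hφ hn'.le hε0.le hl.le hA3'
  have hcols : ∀ j, ∑ i, X i j ^ 2 ≤ B ^ 2 * n := by
    intro j
    have h1 : l2norm (fun i => X i j) ≤ ⨆ j, l2norm (fun i => X i j) :=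
      le_ciSup (f := fun j => l2norm fun i => X i j) (Set.finite_range _).bddAbove j
    have h2 := h1.trans ((le_abs_self _).trans hcol)
    rw [Real.norm_of_nonneg (Real.sqrt_nonneg _)] at h2
    rw [← l2norm_sq fun i => X i j, ← Real.sq_sqrt hn'.le, ← mul_pow]
    exact pow_le_pow_left₀ (Real.sqrt_nonneg _) h2 2
  have hsmall : √(Real.log (R.p n) / n) * maxNorm X ≤ 1 / 2 := by
    have h := (le_abs_self _).trans hmax
    rw [Real.norm_of_nonneg hn'.le] at h
    rw [← Real.sqrt_sq hM0, ← Real.sqrt_mul (by positivity)]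
    refine Real.sqrt_le_iff.2 ⟨by norm_num, ?_⟩
    rw [div_mul_eq_mul_div, div_le_iff₀ hn']
    change maxNorm X ^ 2 * Real.log (R.p n) ≤ _ at h
    linarith
  have hsmall' : (G.radConst + 2) * (maxNorm X * s * √(Real.log (R.p n))) ≤
      1 / 2 * (φ * √n) := by
    calc _ = (G.radConst + 2) * (Kdim + 1) *
          (maxNorm X * R.s₀ n * √(Real.log (R.p n))) := by rw [hs]; ring
      _ ≤ (G.radConst + 2) * (Kdim + 1) * (ε * (φ * √n)) := by gcongr
      _ = _ := by rw [← mul_assoc, hεk]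
  obtain ⟨E, hE, hPE, hyE⟩ := exists_event_mle G X θ₀ hn hp hst.1 hφ (abs_le_maxNorm X) hcols
    hsmall hsmall'
  refine ⟨E, hE, fun y hy S hS => ?_, hPE⟩
  have hrow := hκ.2 S hS
  obtain ⟨S', hS', -, rfl⟩ := hS
  have hcard : (((S' ∪ supp θ₀).card : ℕ) : ℝ) ≤ s := by
    have h1 : (((S' ∪ supp θ₀).card : ℕ) : ℝ) ≤ S'.card + (supp θ₀).card := by
      exact_mod_cast Finset.card_union_le _ _
    have h2 := hS'.1
    have h3 : R.s₀ n = (supp θ₀).card := rfl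
    rw [hs, h3]
    linarith
  obtain ⟨hex, hbound⟩ := hyE y hy _ Finset.subset_union_right hcard
  refine ⟨hex, fun θ hθ j => (hbound θ hθ j).trans ?_⟩
  have hMs' : maxNorm X * R.s₀ n * √(Real.log (R.p n)) ≤ φ * √n := by
    have : 0 ≤ φ * √n := by positivity
    nlinarith
  have hsum := score_add_remainder_le (c := G.radConst) hn' hC.le (sigmaMaxSq_nonneg G X θ₀)
    hB0.le hL.le hk.le hl.le hMs' (phi2_le G hn hst.1 hs1' hφ hB0.le hcols)
    (one_add_sigmaMaxSq_le_nu G X θ₀)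
  have hσ0 := sigmaMaxSq_nonneg G X θ₀
  have hs0 : 0 ≤ s := by linarith
  have hκ0 : 0 < κ n := by linarith [hκ.1]
  refine (mul_le_mul hrow hsum (by positivity) (by positivity)).trans (le_of_eq ?_)
  have hroot : √(n * Real.log (R.p n)) = n * √(R.logp n / n) := by
    have e : n * Real.log (R.p n) = (n : ℝ) ^ 2 * (R.logp n / n) := by
      rw [Regime.logp]; field_simp
    rw [e, Real.sqrt_mul (by positivity), Real.sqrt_sq hn'.le]
  rw [hroot]
  field_simp
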